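/- Let $k$ be an algebraically closed field and let $G$ be a finite group whose order is not divisible by $\operatorname{char}(k)$. A variety over $k$ is an integral separated scheme of finite type over $k$. Let $X$ be a variety over $k$ on which $G$ acts faithfully by $k$-automorphisms, and let $\pi\colon X\to Y$ be the quotient of $X$ by $G$, where $Y$ is a variety over $k$: $\pi$ is a $G$-invariant $k$-morphism, $Y$ is as a topological space the quotient of $X$ by $G$, and for every open $U\subseteq Y$ the map $\pi^\#\colon\mathcal O_Y(U)\to\mathcal O_X(\pi^{-1}(U))$ is injective with image the $G$-invariant functions. Then $\pi_*\mathcal O_X$ is an $\mathcal O_Y$-module with an $\mathcal O_Y$-linear action of $G$ (the element $g$ sends a function $s$ to $s\circ g^{-1}$). Let $V_0,V_1,\dots,V_r$ be the irreducible representations of $G$ over $k$ up to isomorphism, each listed once, with $V_0$ the trivial one, and for a finite-dimensional representation $V$ let $\mathcal O(V)=\mathcal O_Y\otimes_k V$, with $G$ acting through $V$. Then there are torsion-free coherent $\mathcal O_Y$-modules $\mathcal E_{V_1},\dots,\mathcal E_{V_r}$ and a $G$-equivariant isomorphism of $\mathcal O_Y$-modules $$\pi_*\mathcal O_X\;\cong\;\mathcal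 O_Y\oplus\bigoplus_{i=1}^r \mathcal O(V_i)\otimes_{\mathcal O_Y}\mathcal E_{V_i},$$ where $G$ acts trivially on $\mathcal O_Y$ and on $\mathcal E_{V_i}$, and where the summand $\mathcal O_Y$ is embedded in $\pi_*\mathcal O_X$ by $\pi^\#$. Moreover $\operatorname{rank}\mathcal E_{V_i}=\dim_k V_i$ for every $i\ge 1$, where the rank of an $\mathcal O_Y$-module is the dimension of its stalk at the generic point of $Y$ over the function field $K(Y)$. -/

import Mathlib

open CategoryTheory CategoryTheory.Limits AlgebraicGeometry Opposite TopologicalSpace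
open scoped TensorProduct

universe v u

noncomputable section

namespace GaloisCover

variable {k : Type u} [Field k]

/-- A variety over `k` (used for algebraically closed `k`): an integral separated scheme of finite
type over `k`. -/
class IsVariety (X : Over (Spec (.of k))) : Prop where
  isIntegral : IsIntegral X.left
  isSeparated : IsSeparated X.hom
  locallyOfFiniteType : LocallyOfFiniteType X.hom
  quasiCompact : QuasiCompact X.hom

attribute [instance] IsVariety.isIntegral IsVariety.isSeparated IsVariety.locallyOfFiniteType
  IsVariety.quasiCompact

/-! ### The structure sheaf and the sheaves `𝒪(V) = 𝒪_Y ⊗_k V` -/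

/-- The structure sheaf as a module over itself. -/
def structureModule (Y : Scheme.{u}) : Y.Modules := SheafOfModules.unit Y.ringCatSheaf

/-- Sections of the structure sheaf of a `k`-scheme form a `k`-algebra. -/
@[reducible] def algebraSections (Y : Over (Spec (.of k))) (U : Y.left.Opens) :
    Algebra k Γ(Y.left, U) :=
  ((Scheme.ΓSpecIso (.of k)).inv ≫ Y.hom.appTop ≫
    Y.left.presheaf.map (homOfLE le_top).op).hom.toAlgebra

attribute [local instance] algebraSections

/-- Restriction of functions, as a `k`-linear map. -/
def resLinear (Y : Over (Spec (.of k))) {U V : Y.left.Opens} (i : U ⟶ V) :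
    Γ(Y.left, V) →ₗ[k] Γ(Y.left, U) where
  toFun := Y.left.presheaf.map i.op
  map_add' := map_add _
  map_smul' c s := by
    have h : Y.left.presheaf.map i.op (algebraMap k Γ(Y.left, V) c) =
        algebraMap k Γ(Y.left, U) c := by
      simp only [RingHom.algebraMap_toAlgebra]
      change (((Scheme.ΓSpecIso (.of k)).inv ≫ Y.hom.appTop ≫
        Y.left.presheaf.map (homOfLE le_top).op) ≫ Y.left.presheaf.map i.op) c = _
      simp only [Category.assoc, ← Functor.map_comp]
      rfl
    rw [Algebra.smul_def, map_mul, h, RingHom.id_apply, Algebra.smul_def]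

section

variable (Y : Over (Spec (.of k)))
variable (V : Type u) [AddCommGroup V] [Module k V]
variable {W : Type u} [AddCommGroup W] [Module k W]

/-- The presheaf of abelian groups `U ↦ 𝒪_Y(U) ⊗_k V`. -/
def tensorPresheafAb : TopCat.Presheaf Ab.{u} Y.left where
  obj U := AddCommGrpCat.of (Γ(Y.left, U.unop) ⊗[k] V)
  map i := AddCommGrpCat.ofHom ((resLinear Y i.unop).rTensor V).toAddMonoidHom
  map_id U := by
    ext x
    induction x using TensorProduct.induction_on with
    | zero => simp
    | tmul a b => simp [resLinear]
    | add a b ha hb => rw [map_add, ha, hb, map_add]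
  map_comp i j := by
    ext x
    induction x using TensorProduct.induction_on with
    | zero => simp
    | tmul a b => simp [resLinear]
    | add a b ha hb => rw [map_add, ha, hb, map_add]

instance (U : Y.left.Opensᵒᵖ) :
    Module (Y.left.ringCatSheaf.obj.obj U) ((tensorPresheafAb Y V).obj U) :=
  inferInstanceAs (Module Γ(Y.left, U.unop) (Γ(Y.left, U.unop) ⊗[k] V))

lemma rTensor_resLinear_smul {A B : Y.left.Opens} (i : B ⟶ A) (r : Γ(Y.left, A))
    (m : Γ(Y.left, A) ⊗[k] V) :
    (resLinear Y i).rTensor V (r • m) =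
      Y.left.presheaf.map i.op r • (resLinear Y i).rTensor V m := by
  induction m using TensorProduct.induction_on with
  | zero => simp
  | tmul a b => simp [resLinear, TensorProduct.smul_tmul']
  | add a b ha hb => rw [smul_add, map_add, ha, hb, map_add, smul_add]

/-- The presheaf of `𝒪_Y`-modules `U ↦ 𝒪_Y(U) ⊗_k V`. -/
def tensorPresheaf : Y.left.PresheafOfModules :=
  PresheafOfModules.ofPresheaf (tensorPresheafAb Y V)
    (fun _ _ i r m ↦ rTensor_resLinear_smul Y V i.unop r m)

/-- The coordinate of a section of `𝒪_Y ⊗_k V` along a linear form on `V`. -/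
def coordinate (l : V →ₗ[k] k) (U : Y.left.Opens) : Γ(Y.left, U) ⊗[k] V →ₗ[k] Γ(Y.left, U) :=
  (TensorProduct.rid k Γ(Y.left, U)).toLinearMap ∘ₗ l.lTensor Γ(Y.left, U)

lemma coordinate_res (l : V →ₗ[k] k) {A B : Y.left.Opens} (i : B ⟶ A)
    (m : Γ(Y.left, A) ⊗[k] V) :
    coordinate Y V l B ((resLinear Y i).rTensor V m) =
      Y.left.presheaf.map i.op (coordinate Y V l A m) := by
  induction m using TensorProduct.induction_on with
  | zero => simp
  | tmul a b =>
    change _ = resLinear Y i _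
    simp [coordinate]
  | add a b ha hb => simp only [map_add, ha, hb]

lemma eq_of_coordinate_eq {ι : Type*} [Finite ι] (b : Module.Basis ι k V) {U : Y.left.Opens}
    {x y : Γ(Y.left, U) ⊗[k] V}
    (h : ∀ i, coordinate Y V (b.coord i) U x = coordinate Y V (b.coord i) U y) : x = y := by
  have := Fintype.ofFinite ι
  have key (z : Γ(Y.left, U) ⊗[k] V) :
      z = ∑ i, coordinate Y V (b.coord i) U z ⊗ₜ[k] b i := by
    induction z using TensorProduct.induction_on with
    | zero => simp
    | tmul a v =>
      simp only [coordinate, LinearMap.comp_apply, LinearMap.lTensor_tmul,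
        LinearEquiv.coe_coe, TensorProduct.rid_tmul, Module.Basis.coord_apply,
        TensorProduct.smul_tmul, ← TensorProduct.tmul_sum, b.sum_repr]
    | add a c ha hc =>
      simp only [map_add, TensorProduct.add_tmul, Finset.sum_add_distrib, ← ha, ← hc]
  rw [key x, key y]
  simp only [h]

/-- For a finite-dimensional `V`, the presheaf `U ↦ 𝒪_Y(U) ⊗_k V` is already a sheaf. -/
lemma tensorPresheafAb_isSheaf [Module.Finite k V] : (tensorPresheafAb Y V).IsSheaf := by
  rw [TopCat.Presheaf.isSheaf_iff_isSheafUniqueGluing]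
  intro ι U sf hsf
  let b := Module.finBasis k V
  let sf' : ∀ i, Γ(Y.left, U i) ⊗[k] V := sf
  have hc (j) := Y.left.sheaf.existsUnique_gluing U
    (fun i ↦ (coordinate Y V (b.coord j) (U i) (sf' i) : Γ(Y.left, U i))) (fun i i' ↦ by
      have h : (resLinear Y (Opens.infLELeft (U i) (U i'))).rTensor V (sf' i) =
        (resLinear Y (Opens.infLERight (U i) (U i'))).rTensor V (sf' i') := hsf i i'
      have h1 := coordinate_res Y V (b.coord j) (Opens.infLELeft (U i) (U i')) (sf' i)
      have h2 := coordinate_res Y V (b.coord j) (Opens.infLERight (U i) (U i')) (sf' i')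
      exact h1.symm.trans ((congrArg _ h).trans h2))
  choose t ht ht' using hc
  let t' : ∀ j, Γ(Y.left, iSup U) := t
  have coord_t (j) : coordinate Y V (b.coord j) (iSup U) (∑ i, t' i ⊗ₜ[k] b i) = t' j := by
    simp [coordinate, Finsupp.single_apply]
  refine ⟨(∑ i, t' i ⊗ₜ[k] b i : Γ(Y.left, iSup U) ⊗[k] V), fun i ↦ ?_, fun s hs ↦ ?_⟩
  · refine eq_of_coordinate_eq Y V b fun j ↦ ?_
    refine (coordinate_res Y V (b.coord j) (Opens.leSupr U i) _).trans ?_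
    rw [coord_t]
    exact ht j i
  · refine eq_of_coordinate_eq Y V b fun j ↦ ?_
    rw [coord_t]
    refine ht' j _ fun i ↦ ?_
    refine (coordinate_res Y V (b.coord j) (Opens.leSupr U i) s).symm.trans ?_
    exact congrArg (coordinate Y V (b.coord j) (U i)) (hs i)

/-- The sheaf of `𝒪_Y`-modules `𝒪(V) = 𝒪_Y ⊗_k V`, for a finite-dimensional vector space `V`. -/
def freeSheaf [Module.Finite k V] : Y.left.Modules where
  val := tensorPresheaf Y V
  isSheaf := tensorPresheafAb_isSheaf Y V

variable {V} in
/-- Functoriality of `𝒪(V)` in `V`: on sections it is `s ⊗ v ↦ s ⊗ f v`. -/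
def freeSheafMap [Module.Finite k V] [Module.Finite k W] (f : V →ₗ[k] W) :
    freeSheaf Y V ⟶ freeSheaf Y W where
  val := PresheafOfModules.homMk (M₁ := tensorPresheaf Y V) (M₂ := tensorPresheaf Y W)
    { app U := AddCommGrpCat.ofHom (f.lTensor Γ(Y.left, U.unop)).toAddMonoidHom
      naturality A B i := by
        ext x
        change f.lTensor _ ((resLinear Y i.unop).rTensor V x) =
          (resLinear Y i.unop).rTensor W (f.lTensor _ x)
        exact DFunLike.congr_fun ((LinearMap.lTensor_comp_rTensor _ _ _).trans
          (LinearMap.rTensor_comp_lTensor _ _ _).symm) (show Γ(Y.left, A.unop) ⊗[k] V from x) }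
    (fun U r m ↦ (f.baseChange Γ(Y.left, U.unop)).map_smul r m)

lemma freeSheafMap_id [Module.Finite k V] :
    freeSheafMap Y (LinearMap.id : V →ₗ[k] V) = 𝟙 (freeSheaf Y V) := by
  ext U x
  exact DFunLike.congr_fun (LinearMap.lTensor_id Γ(Y.left, U) V)
    (show Γ(Y.left, U) ⊗[k] V from x)

variable {V} in
lemma freeSheafMap_comp [Module.Finite k V] [Module.Finite k W] {Z : Type u} [AddCommGroup Z]
    [Module k Z] [Module.Finite k Z] (f : V →ₗ[k] W) (g : W →ₗ[k] Z) :
    freeSheafMap Y (g ∘ₗ f) = freeSheafMap Y f ≫ freeSheafMap Y g := by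
  ext U x
  exact DFunLike.congr_fun (LinearMap.lTensor_comp Γ(Y.left, U) g f)
    (show Γ(Y.left, U) ⊗[k] V from x)

end

/-! ### Tensor products of sheaves of modules -/

section

variable {S : Scheme.{u}}

/-- The tensor product of presheaves of `𝒪_S`-modules: `U ↦ P(U) ⊗ Q(U)`, the tensor product being
taken over `𝒪_S(U)`. -/
def tensorPresheaves (P Q : S.PresheafOfModules) : S.PresheafOfModules :=
  PresheafOfModules.Monoidal.tensorObj (R := S.presheaf) P Q

/-- The tensor product of two morphisms of presheaves of `𝒪_S`-modules. -/
def tensorPresheavesMap {P P' Q Q' : S.PresheafOfModules} (f : P ⟶ P') (g : Q ⟶ Q') :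
    tensorPresheaves P Q ⟶ tensorPresheaves P' Q' :=
  PresheafOfModules.Monoidal.tensorHom (R := S.presheaf) f g

lemma tensorPresheavesMap_id (P Q : S.PresheafOfModules) :
    tensorPresheavesMap (𝟙 P) (𝟙 Q) = 𝟙 (tensorPresheaves P Q) :=
  MonoidalCategory.id_tensorHom_id
    (C := PresheafOfModules.{u} (S.presheaf ⋙ forget₂ CommRingCat RingCat)) P Q

lemma tensorPresheavesMap_comp {P P' P'' Q Q' Q'' : S.PresheafOfModules} (f : P ⟶ P')
    (f' : P' ⟶ P'') (g : Q ⟶ Q') (g' : Q' ⟶ Q'') :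
    tensorPresheavesMap (f ≫ f') (g ≫ g') =
      tensorPresheavesMap f g ≫ tensorPresheavesMap f' g' :=
  (MonoidalCategory.tensorHom_comp_tensorHom
    (C := PresheafOfModules.{u} (S.presheaf ⋙ forget₂ CommRingCat RingCat)) f g f' g').symm

/-- The tensor product `M ⊗ N` of two `𝒪_S`-modules: the sheaf associated with the presheaf
`U ↦ M(U) ⊗ N(U)`. -/
def tensorModules (M N : S.Modules) : S.Modules :=
  (PresheafOfModules.sheafification (𝟙 S.ringCatSheaf.obj)).obj (tensorPresheaves M.val N.val)

/-- The tensor product of two morphisms of `𝒪_S`-modules. -/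
def tensorModulesMap {M M' N N' : S.Modules} (f : M ⟶ M') (g : N ⟶ N') :
    tensorModules M N ⟶ tensorModules M' N' :=
  (PresheafOfModules.sheafification (𝟙 S.ringCatSheaf.obj)).map (tensorPresheavesMap f.val g.val)

lemma tensorModulesMap_id (M N : S.Modules) :
    tensorModulesMap (𝟙 M) (𝟙 N) = 𝟙 (tensorModules M N) := by
  have h := congrArg (PresheafOfModules.sheafification (𝟙 S.ringCatSheaf.obj)).map
    (tensorPresheavesMap_id M.val N.val)
  rw [CategoryTheory.Functor.map_id] at h
  exact h

lemma tensorModulesMap_comp {M M' M'' N N' N'' : S.Modules} (f : M ⟶ M') (f' : M' ⟶ M'')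
    (g : N ⟶ N') (g' : N' ⟶ N'') :
    tensorModulesMap (f ≫ f') (g ≫ g') = tensorModulesMap f g ≫ tensorModulesMap f' g' := by
  have h := congrArg (PresheafOfModules.sheafification (𝟙 S.ringCatSheaf.obj)).map
    (tensorPresheavesMap_comp f.val f'.val g.val g'.val)
  rw [CategoryTheory.Functor.map_comp] at h
  exact h

end

/-! ### `𝒪_Y[G]`-modules

An `𝒪_Y[G]`-module is an `𝒪_Y`-module with an action of `G` by `𝒪_Y`-linear automorphisms, that is,
an object of `Action Y.left.Modules G`. -/

variable {G : Type v} [Group G]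

/-- The `𝒪_Y[G]`-module `𝒪(V) ⊗ E`, for a representation `V` of `G` and an `𝒪_Y`-module `E`; the
group acts through `V`. -/
def isotypicModule (Y : Over (Spec (.of k))) (V : FDRep k G) (E : Y.left.Modules) :
    Action Y.left.Modules G where
  V := tensorModules (freeSheaf Y V) E
  ρ :=
    { toFun g := tensorModulesMap (freeSheafMap Y (V.ρ g)) (𝟙 E)
      map_one' := by
        rw [map_one]
        exact (congrArg (tensorModulesMap · (𝟙 E)) (freeSheafMap_id Y V)).trans
          (tensorModulesMap_id _ _)
      map_mul' g h := by
        rw [map_mul]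
        refine (congrArg (tensorModulesMap · (𝟙 E))
          (freeSheafMap_comp Y (V.ρ h) (V.ρ g))).trans ?_
        refine Eq.trans ?_ (tensorModulesMap_comp _ _ _ _)
        rw [Category.comp_id] }

variable {X Y : Over (Spec (.of k))}

/-- The comorphism `f^# : 𝒪_T ⟶ f_* 𝒪_S` of a morphism of schemes. -/
def comorphism {S T : Scheme.{u}} (f : S ⟶ T) :
    structureModule T ⟶ (Scheme.Modules.pushforward f).obj (structureModule S) :=
  SheafOfModules.unitToPushforwardObjUnit f.toRingCatSheafHom

/-- An automorphism `σ` of `S` with `σ ≫ f = f` acts on `f_* 𝒪_S` by pulling back functions along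
`σ`. -/
def pullbackFunctions {S T : Scheme.{u}} (f : S ⟶ T) (σ : S ⟶ S) (h : σ ≫ f = f) :
    (Scheme.Modules.pushforward f).obj (structureModule S) ⟶
      (Scheme.Modules.pushforward f).obj (structureModule S) :=
  (Scheme.Modules.pushforward f).map (comorphism σ) ≫
    (Scheme.Modules.pushforwardComp σ f).hom.app _ ≫
      (Scheme.Modules.pushforwardCongr h).hom.app _

lemma le_preimage {S T : Scheme.{u}} {f : S ⟶ T} {σ : S ⟶ S} (h : σ ≫ f = f) (U : T.Opens) :
    f ⁻¹ᵁ U ≤ σ ⁻¹ᵁ (f ⁻¹ᵁ U) := by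
  rw [← Scheme.Hom.comp_preimage, h]

/-- On sections `pullbackFunctions` is the pullback of functions. -/
lemma pullbackFunctions_app {S T : Scheme.{u}} (f : S ⟶ T) (σ : S ⟶ S) (h : σ ≫ f = f)
    (U : T.Opens) (s : Γ(S, f ⁻¹ᵁ U)) :
    (pullbackFunctions f σ h).app U s = σ.appLE (f ⁻¹ᵁ U) (f ⁻¹ᵁ U) (le_preimage h U) s := by
  rfl

lemma pullbackFunctions_id {S T : Scheme.{u}} (f : S ⟶ T) (σ : S ⟶ S) (h : σ ≫ f = f)
    (hσ : σ = 𝟙 S) : pullbackFunctions f σ h = 𝟙 _ := by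
  subst hσ
  refine Scheme.Modules.hom_ext _ _ fun U ↦ ?_
  ext s
  refine (pullbackFunctions_app _ _ _ U s).trans ?_
  have key : Scheme.Hom.appLE (𝟙 S) (f ⁻¹ᵁ U) (f ⁻¹ᵁ U) (le_preimage h U) = 𝟙 _ := by
    simp only [Scheme.Hom.appLE, Scheme.Hom.id_app]
    exact (Category.id_comp _).trans (S.presheaf.map_id _)
  exact congrArg (fun φ : Γ(S, f ⁻¹ᵁ U) ⟶ Γ(S, f ⁻¹ᵁ U) ↦ φ s) key

lemma pullbackFunctions_comp {S T : Scheme.{u}} (f : S ⟶ T) (σ τ ρ : S ⟶ S) (h : σ ≫ f = f)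
    (h' : τ ≫ f = f) (h'' : ρ ≫ f = f) (hρ : ρ = σ ≫ τ) :
    pullbackFunctions f ρ h'' = pullbackFunctions f τ h' ≫ pullbackFunctions f σ h := by
  subst hρ
  refine Scheme.Modules.hom_ext _ _ fun U ↦ ?_
  ext s
  refine (pullbackFunctions_app _ _ _ U s).trans ?_
  rw [← Scheme.Hom.appLE_comp_appLE σ τ _ _ _ (le_preimage h' U) (le_preimage h U)]
  rfl

/-- `π : X ⟶ Y` is a quotient of `X` by the action `a` of `G`: as a topological space `Y` is the
quotient of `X` by `G`, and the functions on an open `U` of `Y` are the `G`-invariant functions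
on `π⁻¹(U)`. -/
structure IsQuotient (a : G →* Aut X) (π : X ⟶ Y) : Prop where
  invariant : ∀ g, (a g).hom ≫ π = π
  isQuotientMap : Topology.IsQuotientMap π.left
  exists_of_eq : ∀ x x' : X.left, π.left x = π.left x' → ∃ g, (a g).hom.left x = x'
  injective : ∀ U : Y.left.Opens, Function.Injective (π.left.app U)
  exists_of_invariant : ∀ (U : Y.left.Opens) (s : Γ(X.left, π.left ⁻¹ᵁ U)),
    (∀ g, (a g).hom.left.appLE (π.left ⁻¹ᵁ U) (π.left ⁻¹ᵁ U)
      (le_preimage (congrArg CommaMorphism.left (invariant g)) U) s = s) →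
    ∃ t : Γ(Y.left, U), π.left.app U t = s

/-- The `𝒪_Y[G]`-module `π_* 𝒪_X`, for an action `a` of `G` on `X` and a `G`-invariant `π : X ⟶ Y`.
The element `g` sends a function `s` to `s ∘ g⁻¹`. -/
def pushforwardModule (a : G →* Aut X) (π : X ⟶ Y) (h : ∀ g, (a g).hom ≫ π = π) :
    Action Y.left.Modules G where
  V := (Scheme.Modules.pushforward π.left).obj (structureModule X.left)
  ρ :=
    { toFun g := pullbackFunctions π.left (a g⁻¹).hom.left (congrArg CommaMorphism.left (h g⁻¹))
      map_one' := pullbackFunctions_id _ _ _ (by rw [inv_one, map_one]; rfl)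
      map_mul' g g' := pullbackFunctions_comp _ _ _ _ _ _ _ (by
        rw [mul_inv_rev, map_mul]; rfl) }

/-! ### Coherence, torsion and rank -/

/-- Coherence of a sheaf of modules on a locally noetherian scheme: it is quasi-coherent, with
finitely generated modules of sections over the affine open subsets. -/
def IsCoherent {S : Scheme.{u}} (M : S.Modules) : Prop :=
  M.IsQuasicoherent ∧ ∀ U : S.Opens, IsAffineOpen U → Module.Finite Γ(S, U) Γ(M, U)

/-- A sheaf of modules on an integral scheme is torsion-free if no nonzero section is killed by a
nonzero function. -/
def IsTorsionFree {S : Scheme.{u}} (M : S.Modules) : Prop :=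
  ∀ (U : S.Opens) (r : Γ(S, U)) (m : Γ(M, U)), r • m = 0 → r = 0 ∨ m = 0

/-- The stalk of a sheaf of modules at the generic point of an integral scheme. -/
abbrev GenericStalk {S : Scheme.{u}} [IsIntegral S] (M : S.Modules) : Type u :=
  ↑(TopCat.Presheaf.stalk M.presheaf (genericPoint S))

/-- The generic stalk is a vector space over the function field. -/
instance {S : Scheme.{u}} [IsIntegral S] (M : S.Modules) :
    Module S.functionField (GenericStalk M) :=
  let P : PresheafOfModules.{u} (S.presheaf ⋙ forget₂ CommRingCat RingCat) := M.val
  inferInstanceAs (Module (S.presheaf.stalk (genericPoint S))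
    ↑(TopCat.Presheaf.stalk (C := Ab) P.presheaf (genericPoint S)))

/-- The rank of a sheaf of modules on an integral scheme: the dimension of its generic stalk over
the function field. -/
def rank {S : Scheme.{u}} [IsIntegral S] (M : S.Modules) : Cardinal.{u} :=
  Module.rank S.functionField (GenericStalk M)

instance (S : Scheme.{u}) : HasFiniteBiproducts (Action S.Modules G) :=
  Abelian.hasFiniteBiproducts

end GaloisCover
end

open GaloisCover

noncomputable section
namespace GaloisCover

/-! ### Semisimple algebras over an algebraically closed field -/

section Semisimple

variable {k A ι : Type*} [Field k] [Ring A] [Algebra k A] (W : ι → Type*)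
  [∀ i, AddCommGroup (W i)] [∀ i, Module k (W i)] [∀ i, Module A (W i)]
  [∀ i, IsScalarTower k A (W i)]

lemma exists_forall_end_pi_apply_eq_smul [IsAlgClosed k] [Finite ι] [∀ i, Module.Finite k (W i)]
    [∀ i, IsSimpleModule A (W i)] (h : ∀ i j, Nonempty (W i ≃ₗ[A] W j) → i = j)
    (φ : Module.End A (∀ i, W i)) : ∃ c : ι → k, ∀ m j, φ m j = c j • m j := by
  classical
  have := Fintype.ofFinite ι
  have hc (j : ι) : ∃ c : k, ∀ w, φ (Pi.single j w) j = c • w := by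
    obtain ⟨c, hc⟩ := (IsSimpleModule.algebraMap_end_bijective_of_isAlgClosed
      (A := A) (V := W j) k).2 (LinearMap.proj j ∘ₗ φ ∘ₗ LinearMap.single A W j)
    exact ⟨c, fun w ↦ (DFunLike.congr_fun hc w).symm⟩
  choose c hc using hc
  refine ⟨c, fun m j ↦ ?_⟩
  have h0 (i : ι) (hij : i ≠ j) (w : W i) : φ (Pi.single i w) j = 0 := by
    let f : W i →ₗ[A] W j := LinearMap.proj j ∘ₗ φ ∘ₗ LinearMap.single A W i
    rcases LinearMap.bijective_or_eq_zero f with hf | hf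
    · exact (hij (h i j ⟨LinearEquiv.ofBijective f hf⟩)).elim
    · exact DFunLike.congr_fun hf w
  conv_lhs => rw [← Finset.univ_sum_single m]
  rw [map_sum, Finset.sum_apply, Finset.sum_eq_single j (fun i _ hi ↦ h0 i hi _) (by simp), hc]

theorem pi_toModuleEnd_surjective [IsAlgClosed k] [Finite ι] [IsSemisimpleRing A]
    [∀ i, Module.Finite k (W i)] [∀ i, IsSimpleModule A (W i)]
    (h : ∀ i j, Nonempty (W i ≃ₗ[A] W j) → i = j)
    (f : ∀ i, Module.End k (W i)) : ∃ a : A, ∀ i (w : W i), a • w = f i w := by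
  classical
  have := Fintype.ofFinite ι
  let F : Module.End (Module.End A (∀ i, W i)) (∀ i, W i) :=
    { toFun m i := f i (m i)
      map_add' _ _ := by ext; simp
      map_smul' φ m := by
        obtain ⟨c, hc⟩ := exists_forall_end_pi_apply_eq_smul (k := k) W h φ
        ext i
        simp [hc] }
  let s : Finset (∀ i, W i) := Finset.univ.biUnion fun i ↦
    Finset.univ.image fun l ↦ Pi.single i (Module.finBasis k (W i) l)
  obtain ⟨a, ha⟩ := jacobson_density F s
  refine ⟨a, fun i w ↦ ?_⟩
  have key : Algebra.lsmul k k (W i) a = f i := by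
    refine (Module.finBasis k (W i)).ext fun l ↦ ?_
    have := congrFun (ha (Pi.single i (Module.finBasis k (W i) l)) (by
      simp only [s, Finset.mem_biUnion, Finset.mem_image, Finset.mem_univ, true_and]
      exact ⟨i, l, rfl⟩)) i
    simpa [F] using this.symm
  exact DFunLike.congr_fun key w

theorem eq_zero_of_forall_smul_eq_zero [IsSemisimpleRing A]
    (h : ∀ S : Submodule A A, IsSimpleModule A S → ∃ i, Nonempty (S ≃ₗ[A] W i))
    (a : A) (ha : ∀ i (w : W i), a • w = 0) : a = 0 := by
  have key : ∀ x ∈ sSup {S : Submodule A A | IsSimpleModule A S}, a • x = 0 := by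
    intro x hx
    rw [sSup_eq_iSup'] at hx
    induction hx using Submodule.iSup_induction' with
    | mem S x hx =>
      obtain ⟨i, ⟨e⟩⟩ := h S S.2
      have : a • (⟨x, hx⟩ : S.1) = 0 := e.injective (by rw [map_smul, ha, map_zero])
      exact congrArg Subtype.val this
    | zero => simp
    | add x y _ _ hx hy => rw [smul_add, hx, hy, add_zero]
  rw [IsSemisimpleModule.sSup_simples_eq_top] at key
  simpa using key 1 trivial

end Semisimple

/-! ### Representations as modules over the group algebra -/

section FDRep

variable {k : Type u} [Field k] {G : Type v} [Group G]

/-- The representation underlying an object of `FDRep k G`. -/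
abbrev fdRep (V : FDRep k G) : Representation k G V := V.ρ

/-- An equivariant linear map as a morphism of representations. -/
def fdRepHom {V W : FDRep k G} (f : V →ₗ[k] W) (h : ∀ g v, f (V.ρ g v) = W.ρ g (f v)) : V ⟶ W where
  hom := ⟨ModuleCat.ofHom f⟩
  comm g := by
    ext v
    exact h g v

/-- The linear map underlying a morphism of representations. -/
def fdRepLin {V W : FDRep k G} (f : V ⟶ W) : V →ₗ[k] W := f.hom.hom.hom

lemma fdRepLin_ρ {V W : FDRep k G} (f : V ⟶ W) (g : G) (v : V) :
    fdRepLin f (V.ρ g v) = W.ρ g (fdRepLin f v) :=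
  congrArg (fun φ : V.V ⟶ W.V ↦ φ.hom.hom v) (f.comm g)

lemma fdRep_hom_ext {V W : FDRep k G} {f g : V ⟶ W} (h : ∀ v, fdRepLin f v = fdRepLin g v) :
    f = g := by
  ext v
  exact h v

lemma fdRepLin_injective {V W : FDRep k G} (f : V ⟶ W) [Mono f] :
    Function.Injective (fdRepLin f) := by
  rw [← LinearMap.ker_eq_bot, Submodule.eq_bot_iff]
  intro x hx
  let K := LinearMap.ker (fdRepLin f)
  have hK (g : G) (v : V) (hv : v ∈ K) : V.ρ g v ∈ K := by
    simp only [K, LinearMap.mem_ker] at hv ⊢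
    rw [fdRepLin_ρ, hv, map_zero]
  let ρ : Representation k G K :=
    { toFun g := (V.ρ g).restrict (hK g)
      map_one' := by ext; simp
      map_mul' g h := by ext; simp }
  let i : FDRep.of ρ ⟶ V := fdRepHom (V := FDRep.of ρ) K.subtype fun g v ↦ rfl
  have : i ≫ f = 0 ≫ f := fdRep_hom_ext fun v ↦
    show fdRepLin f v.1 = _ from (LinearMap.mem_ker.mp v.2).trans (map_zero (fdRepLin f)).symm
  rw [cancel_mono] at this
  exact congrArg (fun φ : FDRep.of ρ ⟶ V ↦ fdRepLin φ ⟨x, hx⟩) this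

/-- A bijective equivariant linear map as an isomorphism of representations. -/
def fdRepIso {V W : FDRep k G} (e : V ≃ₗ[k] W) (h : ∀ g v, e (V.ρ g v) = W.ρ g (e v)) : V ≅ W where
  hom := fdRepHom e.toLinearMap h
  inv := fdRepHom e.symm.toLinearMap fun g w ↦ by
    apply e.injective
    change e (e.symm _) = e (V.ρ g (e.symm w))
    rw [h, e.apply_symm_apply, e.apply_symm_apply]
  hom_inv_id := fdRep_hom_ext fun v ↦ e.symm_apply_apply v
  inv_hom_id := fdRep_hom_ext fun v ↦ e.apply_symm_apply v

lemma exists_ne_zero_of_simple (V : FDRep k G) [Simple V] : ∃ v : V, v ≠ 0 := by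
  by_contra! h
  exact id_nonzero V (fdRep_hom_ext fun v ↦ (h _).trans (h _).symm)

lemma finrank_pos_of_simple (V : FDRep k G) [Simple V] : 0 < Module.finrank k V :=
  Module.finrank_pos_iff_exists_ne_zero.mpr (exists_ne_zero_of_simple V)

lemma isSimpleModule_asModule (V : FDRep k G) [Simple V] :
    IsSimpleModule (MonoidAlgebra k G) (fdRep V).asModule := by
  rw [← Representation.irreducible_iff_isSimpleModule_asModule]
  obtain ⟨v₀, hv₀⟩ := exists_ne_zero_of_simple V
  refine { exists_pair_ne := ⟨⊥, ⊤, fun h ↦ hv₀ ?_⟩, eq_bot_or_eq_top p := ?_ }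
  · have : v₀ ∈ (⊥ : Subrepresentation (fdRep V)) := h ▸ trivial
    exact this
  · let i : FDRep.of p.toRepresentation ⟶ V :=
      fdRepHom (V := FDRep.of p.toRepresentation) p.toSubmodule.subtype fun g v ↦ rfl
    have : Mono i := ⟨fun a b hab ↦ fdRep_hom_ext fun v ↦
      Subtype.ext (congrArg (fun φ ↦ fdRepLin φ v) hab)⟩
    by_cases hi : i = 0
    · left
      ext x
      refine ⟨fun hx ↦ ?_, fun hx ↦ ?_⟩
      · exact congrArg (fun φ : FDRep.of p.toRepresentation ⟶ V ↦
          fdRepLin φ (⟨x, hx⟩ : p.toSubmodule)) hi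
      · obtain rfl : x = 0 := hx
        exact p.toSubmodule.zero_mem
    · right
      have : IsIso i := isIso_of_mono_of_nonzero hi
      ext x
      refine ⟨fun _ ↦ trivial, fun _ ↦ ?_⟩
      have := congrArg (fun φ ↦ fdRepLin φ x) (IsIso.inv_hom_id i)
      have h2 : (fdRepLin (inv i) x).1 = x := this
      rw [← h2]
      exact (fdRepLin (inv i) x).2

lemma simple_of_isSimpleModule (V : FDRep k G)
    [IsSimpleModule (MonoidAlgebra k G) (fdRep V).asModule] : Simple V := by
  have : Representation.IsIrreducible (fdRep V) := by
    rwa [Representation.irreducible_iff_isSimpleModule_asModule]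
  refine ⟨fun {W} f _ ↦ ⟨fun _ h0 ↦ ?_, fun hf ↦ ?_⟩⟩
  · have : Nontrivial (fdRep V).asModule := IsSimpleModule.nontrivial (MonoidAlgebra k G) _
    obtain ⟨v, hv⟩ := exists_ne (0 : (fdRep V).asModule)
    refine hv ?_
    have := congrArg (fun φ : V ⟶ V ↦ fdRepLin φ v) (IsIso.inv_hom_id f)
    simp only [h0, comp_zero] at this
    exact this.symm
  · let p : Subrepresentation (fdRep V) :=
      { toSubmodule := LinearMap.range (fdRepLin f)
        apply_mem_toSubmodule := by
          rintro g _ ⟨w, rfl⟩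
          exact ⟨W.ρ g w, fdRepLin_ρ f g w⟩ }
    have hinj := fdRepLin_injective f
    rcases eq_bot_or_eq_top p with hp | hp
    · refine (hf (fdRep_hom_ext fun w ↦ ?_)).elim
      have : fdRepLin f w ∈ p := ⟨w, rfl⟩
      rw [hp] at this
      exact this
    · let e := LinearEquiv.ofBijective (fdRepLin f) ⟨hinj, fun v ↦ by
        have : v ∈ p := hp ▸ trivial
        exact this⟩
      exact (fdRepIso e fun g v ↦ fdRepLin_ρ f g v).isIso_hom

lemma nonempty_iso_of_asModule_equiv {V W : FDRep k G}
    (e : (fdRep V).asModule ≃ₗ[MonoidAlgebra k G] (fdRep W).asModule) : Nonempty (V ≅ W) := by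
  refine ⟨fdRepIso (e.restrictScalars k) fun g v ↦ ?_⟩
  let v' : (fdRep V).asModule := v
  have := e.map_smul (MonoidAlgebra.of k G g) v'
  rw [MonoidAlgebra.of_apply, Representation.single_smul, Representation.single_smul,
    one_smul, one_smul] at this
  exact this

lemma fdRepLin_asAlgebraHom {V W : FDRep k G} (f : V ⟶ W) (a : MonoidAlgebra k G) (v : V) :
    fdRepLin f ((fdRep V).asAlgebraHom a v) = (fdRep W).asAlgebraHom a (fdRepLin f v) := by
  induction a using MonoidAlgebra.induction_on with
  | of g =>
    rw [Representation.asAlgebraHom_of, Representation.asAlgebraHom_of]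
    exact fdRepLin_ρ f g v
  | add a b ha hb => simp only [map_add, LinearMap.add_apply, ha, hb]
  | smul c a ha => simp only [map_smul, LinearMap.smul_apply, ha]

/-- Isomorphic representations give isomorphic modules over the group algebra. -/
def asModuleEquivOfIso {V W : FDRep k G} (f : V ≅ W) :
    (fdRep V).asModule ≃ₗ[MonoidAlgebra k G] (fdRep W).asModule where
  toFun := fdRepLin f.hom
  invFun := fdRepLin f.inv
  left_inv v := congrArg (fun φ : V ⟶ V ↦ fdRepLin φ v) f.hom_inv_id
  right_inv v := congrArg (fun φ : W ⟶ W ↦ fdRepLin φ v) f.inv_hom_id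
  map_add' := map_add (fdRepLin f.hom)
  map_smul' a v := by
    exact fdRepLin_asAlgebraHom f.hom a v

lemma exists_asModule_equiv (S : Type*) [AddCommGroup S] [Module k S] [Module (MonoidAlgebra k G) S]
    [IsScalarTower k (MonoidAlgebra k G) S] [Module.Finite k S] :
    ∃ V : FDRep k G, Nonempty (S ≃ₗ[MonoidAlgebra k G] (fdRep V).asModule) := by
  let n := Module.finrank k S
  let V : Type u := Fin n → k
  let e : S ≃ₗ[k] V := (Module.finBasis k S).equivFun
  let σ : MonoidAlgebra k G →ₐ[k] Module.End k V :=
    e.conjAlgEquiv k |>.toAlgHom.comp (Algebra.lsmul k k S)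
  let ρ : Representation k G V := (σ : MonoidAlgebra k G →* _).comp (MonoidAlgebra.of k G)
  refine ⟨FDRep.of ρ, ⟨{ e with map_smul' := fun a s ↦ ?_ }⟩⟩
  have h : ρ.asAlgebraHom = σ := by
    ext g : 2
    simp [ρ]
  change e (a • s) = ρ.asAlgebraHom a (e s)
  rw [h]
  simp [σ, LinearEquiv.conjAlgEquiv_apply]

/-- Matrix units in the group algebra, for a family `V` of representations: the element `unit i j l`
acts as the elementary matrix `(j, l)` on `V i` and as zero on the other members of the family, and
the `unit i j l` span the group algebra. -/
structure MatrixUnits {ι : Type*} [Fintype ι] (V : ι → FDRep k G) where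
  /-- the matrix units -/
  unit (i : ι) (j l : Fin (Module.finrank k (V i))) : MonoidAlgebra k G
  unit_mul_unit (i j l m) : unit i j l * unit i l m = unit i j m
  unit_mul_unit_of_ne (i j l l' m) (h : l ≠ l') : unit i j l * unit i l' m = 0
  unit_mul_unit_of_index_ne (i i' j l j' l') (h : i ≠ i') : unit i j l * unit i' j' l' = 0
  sum_unit : ∑ i, ∑ j, unit i j j = 1
  of_mul_unit (i m l g) : MonoidAlgebra.of k G g * unit i m l =
    ∑ j, (Module.finBasis k (V i)).coord j ((V i).ρ g (Module.finBasis k (V i) m)) • unit i j l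
  unit_mul_of (i j l g) : unit i j l * MonoidAlgebra.of k G g =
    ∑ m, (Module.finBasis k (V i)).coord l ((V i).ρ g (Module.finBasis k (V i) m)) • unit i j m
  unit_ne_zero (i j l) : unit i j l ≠ 0
  span_unit : Submodule.span k (Set.range fun x : Σ i, Fin (Module.finrank k (V i)) ×
    Fin (Module.finrank k (V i)) ↦ unit x.1 x.2.1 x.2.2) = ⊤
  card_eq : Nat.card (Σ i, Fin (Module.finrank k (V i)) × Fin (Module.finrank k (V i))) = Nat.card G

theorem groupAlgebra_bijective [IsAlgClosed k] [Finite G] (hG : ¬ ringChar k ∣ Nat.card G)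
    {ι : Type*} [Finite ι] (V : ι → FDRep k G) (hV_simple : ∀ i, Simple (V i))
    (hV_inj : ∀ i j, Nonempty (V i ≅ V j) → i = j)
    (hV_surj : ∀ W : FDRep k G, Simple W → ∃ i, Nonempty (W ≅ V i)) :
    Function.Bijective (AlgHom.pi fun i ↦ (fdRep (V i)).asAlgebraHom) := by
  have : NeZero (Nat.card G : k) := ⟨fun h ↦ hG ((ringChar.spec k _).mp h)⟩
  have hs (i : ι) : IsSimpleModule (MonoidAlgebra k G) (fdRep (V i)).asModule :=
    isSimpleModule_asModule (V i)
  refine ⟨?_, fun f ↦ ?_⟩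
  · rw [injective_iff_map_eq_zero]
    refine fun a ha ↦ eq_zero_of_forall_smul_eq_zero (A := MonoidAlgebra k G)
      (fun i ↦ (fdRep (V i)).asModule) (fun S hS ↦ ?_) a fun i w ↦ ?_
    · obtain ⟨W, ⟨e⟩⟩ := exists_asModule_equiv (k := k) (G := G) S
      have : IsSimpleModule (MonoidAlgebra k G) (fdRep W).asModule := IsSimpleModule.congr e.symm
      obtain ⟨i, ⟨f⟩⟩ := hV_surj W (simple_of_isSimpleModule W)
      exact ⟨i, ⟨e.trans (asModuleEquivOfIso f)⟩⟩
    · exact DFunLike.congr_fun (congrFun ha i) w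
  · obtain ⟨a, ha⟩ := pi_toModuleEnd_surjective (k := k) (A := MonoidAlgebra k G)
      (fun i ↦ (fdRep (V i)).asModule)
      (fun i j ⟨e⟩ ↦ hV_inj i j (nonempty_iso_of_asModule_equiv e)) f
    exact ⟨a, funext fun i ↦ LinearMap.ext fun w ↦ ha i w⟩

theorem nonempty_matrixUnits [IsAlgClosed k] [Finite G] (hG : ¬ ringChar k ∣ Nat.card G)
    {ι : Type*} [Fintype ι] (V : ι → FDRep k G) (hV_simple : ∀ i, Simple (V i))
    (hV_inj : ∀ i j, Nonempty (V i ≅ V j) → i = j)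
    (hV_surj : ∀ W : FDRep k G, Simple W → ∃ i, Nonempty (W ≅ V i)) :
    Nonempty (MatrixUnits V) := by
  classical
  let Φ : MonoidAlgebra k G ≃ₐ[k] ∀ i, Module.End k (V i) :=
    AlgEquiv.ofBijective _ (groupAlgebra_bijective hG V hV_simple hV_inj hV_surj)
  have hΦ (g : G) (i) : Φ (MonoidAlgebra.of k G g) i = (V i).ρ g := by
    exact (fdRep (V i)).asAlgebraHom_of g
  let b (i) := Module.finBasis k (V i)
  let E (i) (j l : Fin (Module.finrank k (V i))) : Module.End k (V i) :=
    ((b i).coord l).smulRight (b i j)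
  have hE (i j l v) : E i j l v = (b i).coord l v • b i j := rfl
  let unit (i) (j l : Fin (Module.finrank k (V i))) : MonoidAlgebra k G :=
    Φ.symm (Pi.single i (E i j l))
  have hunit (i j l) : Φ (unit i j l) = Pi.single i (E i j l) := Φ.apply_symm_apply _
  have hsum : ∑ i, ∑ j, unit i j j = 1 := by
    apply Φ.injective
    simp only [map_sum, hunit, map_one]
    ext i v
    simp only [Finset.sum_apply, LinearMap.sum_apply]
    rw [Finset.sum_eq_single i (fun i' _ h ↦ by simp [h.symm]) (by simp)]
    simp [hE, (b i).sum_repr v]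
  have hof (i m l g) : MonoidAlgebra.of k G g * unit i m l =
      ∑ j, (b i).coord j ((V i).ρ g (b i m)) • unit i j l := by
    apply Φ.injective
    simp only [map_mul, map_sum, map_smul, hunit]
    ext i' v
    by_cases h : i' = i
    · subst h
      simp only [Pi.mul_apply, hΦ, Pi.single_eq_same, Finset.sum_apply, Pi.smul_apply,
        Module.End.mul_apply, hE, map_smul, LinearMap.sum_apply, LinearMap.smul_apply]
      simp only [smul_comm _ ((b i').coord l v), ← Finset.smul_sum]
      congr 1
      exact ((b i').sum_repr _).symm
    · simp [h]
  refine ⟨⟨unit, ?_, ?_, ?_, hsum, hof, ?_, ?_, ?_, ?_⟩⟩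
  · intro i j l m
    apply Φ.injective
    rw [map_mul, hunit, hunit, hunit, ← Pi.single_mul]
    congr 1
    ext v
    simp [hE]
  · intro i j l l' m h
    apply Φ.injective
    rw [map_mul, hunit, hunit, ← Pi.single_mul, map_zero]
    convert Pi.single_zero i
    ext v
    simp [hE, h.symm]
  · intro i i' j l j' l' h
    apply Φ.injective
    rw [map_mul, hunit, hunit, map_zero]
    ext i'' v
    by_cases h' : i'' = i
    · subst h'
      simp [h]
    · simp [h']
  · intro i j l g
    apply Φ.injective
    simp only [map_mul, map_sum, map_smul, hunit]
    ext i' v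
    by_cases h : i' = i
    · subst h
      simp only [Pi.mul_apply, hΦ, Pi.single_eq_same, Finset.sum_apply, Pi.smul_apply,
        Module.End.mul_apply, hE, LinearMap.sum_apply, LinearMap.smul_apply]
      simp only [smul_smul, ← Finset.sum_smul]
      congr 1
      conv_lhs => rw [← (b i').sum_repr v]
      simp only [map_sum, map_smul, smul_eq_mul, Module.Basis.coord_apply]
      exact Finset.sum_congr rfl fun _ _ ↦ mul_comm _ _
    · simp [h]
  · intro i j l h
    have h' := hunit i j l
    rw [h, map_zero, eq_comm, Pi.single_eq_zero_iff] at h'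
    have h'' := DFunLike.congr_fun h' (b i l)
    rw [hE, Module.Basis.coord_apply, Module.Basis.repr_self, Finsupp.single_eq_same,
      one_smul] at h''
    exact (b i).ne_zero j h''
  · rw [eq_top_iff]
    intro a _
    induction a using MonoidAlgebra.induction_on with
    | of g =>
      rw [← mul_one (MonoidAlgebra.of k G g), ← hsum, Finset.mul_sum]
      refine Submodule.sum_mem _ fun i _ ↦ ?_
      rw [Finset.mul_sum]
      refine Submodule.sum_mem _ fun m _ ↦ ?_
      rw [hof]
      exact Submodule.sum_mem _ fun j _ ↦ Submodule.smul_mem _ _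
        (Submodule.subset_span ⟨⟨i, j, m⟩, rfl⟩)
    | add a b ha hb => exact Submodule.add_mem _ (ha trivial) (hb trivial)
    | smul c a ha => exact Submodule.smul_mem _ _ (ha trivial)
  · have h := Φ.toLinearEquiv.finrank_eq
    rw [Module.finrank_eq_nat_card_basis (MonoidAlgebra.basis G k), Module.finrank_pi_fintype] at h
    simp only [Module.finrank_linearMap] at h
    rw [h, Nat.card_eq_fintype_card]
    simp

end FDRep

end GaloisCover
end

noncomputable section
namespace GaloisCover

/-! ### Pure tensors in the tensor product of sheaves of modules -/

section Tensor

variable {S : Scheme.{u}} {M M' N N' F : S.Modules}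

variable (M N) in
/-- The canonical map from the presheaf tensor product to the tensor product. -/
def toTensorModules : tensorPresheaves M.val N.val ⟶
    (PresheafOfModules.restrictScalars (𝟙 S.ringCatSheaf.obj)).obj (tensorModules M N).val :=
  (PresheafOfModules.sheafificationAdjunction (𝟙 S.ringCatSheaf.obj)).unit.app
    (tensorPresheaves M.val N.val)

variable (M N) in
/-- The canonical map `M(U) ⊗ N(U) → (M ⊗ N)(U)`. -/
def tensorSections (U : S.Opens) :
    Γ(M, U) ⊗[Γ(S, U)] Γ(N, U) →ₗ[Γ(S, U)] Γ(tensorModules M N, U) where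
  toFun x := (toTensorModules M N).app (op U) x
  map_add' x y := map_add ((toTensorModules M N).app (op U)).hom x y
  map_smul' a x := ((toTensorModules M N).app (op U)).hom.map_smul a x

/-- The pure tensor `m ⊗ n` as a section of `M ⊗ N`. -/
def pureTensor {U : S.Opens} (m : Γ(M, U)) (n : Γ(N, U)) : Γ(tensorModules M N, U) :=
  tensorSections M N U (m ⊗ₜ n)

lemma pureTensor_add_left {U : S.Opens} (m m' : Γ(M, U)) (n : Γ(N, U)) :
    pureTensor (m + m') n = pureTensor m n + pureTensor m' n := by
  simp only [pureTensor, TensorProduct.add_tmul, map_add]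

lemma pureTensor_add_right {U : S.Opens} (m : Γ(M, U)) (n n' : Γ(N, U)) :
    pureTensor m (n + n') = pureTensor m n + pureTensor m n' := by
  simp only [pureTensor, TensorProduct.tmul_add, map_add]

lemma pureTensor_smul_right {U : S.Opens} (a : Γ(S, U)) (m : Γ(M, U)) (n : Γ(N, U)) :
    pureTensor m (a • n) = a • pureTensor m n := by
  simp only [pureTensor, TensorProduct.tmul_smul, map_smul]

lemma pureTensor_smul_left {U : S.Opens} (a : Γ(S, U)) (m : Γ(M, U)) (n : Γ(N, U)) :
    pureTensor (a • m) n = a • pureTensor m n := by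
  simp only [pureTensor, ← TensorProduct.smul_tmul', map_smul]

lemma pureTensor_sum_left {ι : Type*} (s : Finset ι) {U : S.Opens} (m : ι → Γ(M, U)) (n : Γ(N, U)) :
    pureTensor (∑ i ∈ s, m i) n = ∑ i ∈ s, pureTensor (m i) n := by
  simp only [pureTensor, TensorProduct.sum_tmul, map_sum]

lemma map_pureTensor {U V : S.Opens} (i : U ⟶ V) (m : Γ(M, V)) (n : Γ(N, V)) :
    (tensorModules M N).presheaf.map i.op (pureTensor m n) =
      pureTensor (M.presheaf.map i.op m) (N.presheaf.map i.op n) := by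
  let x : Γ(M, V) ⊗[Γ(S, V)] Γ(N, V) := m ⊗ₜ n
  exact (PresheafOfModules.naturality_apply (toTensorModules M N) i.op x).symm

lemma tensorModulesMap_pureTensor (f : M ⟶ M') (g : N ⟶ N') {U : S.Opens} (m : Γ(M, U))
    (n : Γ(N, U)) : (tensorModulesMap f g).app U (pureTensor m n) =
      pureTensor (f.app U m) (g.app U n) := by
  let x : Γ(M, U) ⊗[Γ(S, U)] Γ(N, U) := m ⊗ₜ n
  have h := (PresheafOfModules.sheafificationAdjunction (𝟙 S.ringCatSheaf.obj)).unit.naturality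
    (tensorPresheavesMap f.val g.val)
  exact (congrArg (fun φ ↦ PresheafOfModules.Hom.app φ (op U) x) h).symm

lemma tensorModules_hom_ext {f g : tensorModules M N ⟶ F}
    (h : ∀ (U : S.Opens) (m : Γ(M, U)) (n : Γ(N, U)),
      f.app U (pureTensor m n) = g.app U (pureTensor m n)) : f = g := by
  have key (f : tensorModules M N ⟶ F) :=
    (PresheafOfModules.sheafificationAdjunction (𝟙 S.ringCatSheaf.obj)).homEquiv_unit
      (X := tensorPresheaves M.val N.val) (Y := F) (f := f)
  apply ((PresheafOfModules.sheafificationAdjunction (𝟙 S.ringCatSheaf.obj)).homEquiv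
    (tensorPresheaves M.val N.val) F).injective
  refine (key f).trans (Eq.trans ?_ (key g).symm)
  ext U x
  change f.app U.unop (tensorSections M N U.unop x) = g.app U.unop (tensorSections M N U.unop x)
  generalize hx : (show Γ(M, U.unop) ⊗[Γ(S, U.unop)] Γ(N, U.unop) from x) = x'
  clear hx x
  induction x' using TensorProduct.induction_on with
  | zero => simp only [map_zero]
  | tmul m n => exact h U.unop m n
  | add a b ha hb => simp only [map_add, ha, hb]

/-- A morphism out of the presheaf tensor product into a sheaf extends to the tensor product. -/
def tensorModulesDesc (β : tensorPresheaves M.val N.val ⟶ F.val) : tensorModules M N ⟶ F :=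
  ((PresheafOfModules.sheafificationAdjunction (𝟙 S.ringCatSheaf.obj)).homEquiv
    (tensorPresheaves M.val N.val) F).symm
    (PresheafOfModules.homMk (M₁ := tensorPresheaves M.val N.val)
      (M₂ := (PresheafOfModules.restrictScalars (𝟙 S.ringCatSheaf.obj)).obj F.val)
      ((PresheafOfModules.toPresheaf _).map β) fun U a x ↦ (β.app U).hom.map_smul a x)

lemma tensorModulesDesc_pureTensor (β : tensorPresheaves M.val N.val ⟶ F.val) {U : S.Opens}
    (m : Γ(M, U)) (n : Γ(N, U)) : (tensorModulesDesc β).app U (pureTensor m n) =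
      β.app (op U) (show Γ(M, U) ⊗[Γ(S, U)] Γ(N, U) from m ⊗ₜ n) := by
  let x : Γ(M, U) ⊗[Γ(S, U)] Γ(N, U) := m ⊗ₜ n
  have h := ((PresheafOfModules.sheafificationAdjunction (𝟙 S.ringCatSheaf.obj)).homEquiv_unit
    (X := tensorPresheaves M.val N.val) (Y := F) (f := tensorModulesDesc β)).symm.trans
      (Equiv.apply_symm_apply _ _)
  exact (congrArg (fun φ ↦ PresheafOfModules.Hom.app φ (op U) x) h)

end Tensor
end GaloisCover
end

noncomputable section
namespace GaloisCover

/-! ### Morphisms of sheaves of modules, scalars -/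

/-- A morphism of sheaves of modules from a compatible family of linear maps on sections. -/
def modulesHomMk {S : Scheme.{u}} {M N : S.Modules} (f : ∀ U : S.Opens, Γ(M, U) →ₗ[Γ(S, U)] Γ(N, U))
    (h : ∀ (U V : S.Opens) (i : U ⟶ V) (m : Γ(M, V)),
      f U (M.presheaf.map i.op m) = N.presheaf.map i.op (f V m)) : M ⟶ N where
  val := PresheafOfModules.homMk (M₁ := M.val) (M₂ := N.val)
    { app U := AddCommGrpCat.ofHom (f U.unop).toAddMonoidHom
      naturality A B i := by
        ext x
        exact h B.unop A.unop i.unop x }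
    (fun U r m ↦ (f U.unop).map_smul r m)

lemma modules_hom_ext {S : Scheme.{u}} {M N : S.Modules} {f g : M ⟶ N}
    (h : ∀ (U : S.Opens) (m : Γ(M, U)), f.app U m = g.app U m) : f = g := by
  ext U m
  exact h U m

lemma modules_sum_app {S : Scheme.{u}} {M N : S.Modules} {ι : Type*} (s : Finset ι)
    (f : ι → (M ⟶ N)) (U : S.Opens) (m : Γ(M, U)) :
    (∑ i ∈ s, f i).app U m = ∑ i ∈ s, (f i).app U m := by
  classical
  induction s using Finset.induction_on with
  | empty => simp
  | insert i s hi ih => rw [Finset.sum_insert hi, Finset.sum_insert hi, ← ih]; rfl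

variable {k : Type u} [Field k]

attribute [local instance] algebraSections

section

variable {Y : Over (Spec (.of k))}

lemma map_algebraMap {U V : Y.left.Opens} (i : U ⟶ V) (c : k) :
    Y.left.presheaf.map i.op (algebraMap k Γ(Y.left, V) c) = algebraMap k Γ(Y.left, U) c := by
  rw [Algebra.algebraMap_eq_smul_one, Algebra.algebraMap_eq_smul_one]
  exact ((resLinear Y i).map_smul c 1).trans
    (congrArg (c • ·) (map_one (Y.left.presheaf.map i.op).hom))

/-- Multiplication by a scalar as an endomorphism of an `𝒪_Y`-module. -/
def scalar (M : Y.left.Modules) (c : k) : M ⟶ M :=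
  modulesHomMk (fun U ↦ algebraMap k Γ(Y.left, U) c • LinearMap.id) fun U V i m ↦ by
    simp only [LinearMap.smul_apply, LinearMap.id_apply, Scheme.Modules.map_smul, map_algebraMap]

lemma scalar_app (M : Y.left.Modules) (c : k) (U : Y.left.Opens) (m : Γ(M, U)) :
    (scalar M c).app U m = algebraMap k Γ(Y.left, U) c • m := rfl

lemma scalar_comp {M N : Y.left.Modules} (c : k) (f : M ⟶ N) :
    scalar M c ≫ f = f ≫ scalar N c :=
  modules_hom_ext fun _ _ ↦ f.app_smul _ _

variable (Y) in
/-- The endomorphisms of an `𝒪_Y`-module form a `k`-algebra. -/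
@[reducible] def algebraEnd (M : Y.left.Modules) : Algebra k (End M) :=
  RingHom.toAlgebra'
    { toFun := scalar M
      map_one' := modules_hom_ext fun _ _ ↦ by simp only [scalar_app, map_one, one_smul]; rfl
      map_zero' := modules_hom_ext fun _ _ ↦ by simp only [scalar_app, map_zero, zero_smul]; rfl
      map_mul' a b := modules_hom_ext fun U m ↦ by
        simp only [scalar_app, map_mul, mul_smul]; rfl
      map_add' a b := modules_hom_ext fun U m ↦ by
        simp only [scalar_app, map_add, add_smul]; rfl }
    fun c f ↦ (scalar_comp c f).symm

attribute [local instance] algebraEnd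

lemma end_smul_eq {M : Y.left.Modules} (c : k) (f : End M) :
    c • f = (f ≫ scalar M c : M ⟶ M) := Algebra.smul_def c f

variable {G : Type v} [Group G]

/-- The action of the group algebra on an `𝒪_Y[G]`-module. -/
def groupAlgebraAction (M : Action Y.left.Modules G) : MonoidAlgebra k G →ₐ[k] End M.V :=
  MonoidAlgebra.lift k (End M.V) G M.ρ

lemma groupAlgebraAction_of (M : Action Y.left.Modules G) (g : G) :
    groupAlgebraAction M (MonoidAlgebra.of k G g) = M.ρ g := by
  exact MonoidAlgebra.lift_of _ _

lemma comp_groupAlgebraAction_of_invariant (M : Action Y.left.Modules G) {F : Y.left.Modules}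
    (c : F ⟶ M.V) (hc : ∀ g, c ≫ M.ρ g = c) (a : MonoidAlgebra k G) :
    c ≫ (groupAlgebraAction M a : M.V ⟶ M.V) =
      c ≫ scalar M.V (MonoidAlgebra.lift k k G 1 a) := by
  induction a using MonoidAlgebra.induction_on with
  | of g =>
    rw [groupAlgebraAction_of, hc, MonoidAlgebra.lift_of, MonoidHom.one_apply]
    exact modules_hom_ext fun U m ↦ by
      change _ = (scalar M.V 1).app U (c.app U m)
      rw [scalar_app, map_one, one_smul]
  | add a b ha hb =>
    rw [map_add, map_add]
    refine (Preadditive.comp_add _ _ _ c _ _).trans ?_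
    rw [ha, hb, ← Preadditive.comp_add]
    congr 1
    exact (map_add (algebraMap k (End M.V)) _ _).symm
  | smul r a ha =>
    rw [map_smul, map_smul, end_smul_eq, reassoc_of% ha, smul_eq_mul]
    congr 1
    exact (map_mul (algebraMap k (End M.V)) _ _).symm

/-! ### The maps between `E` and `𝒪(V) ⊗ E` -/

variable (V : Type u) [AddCommGroup V] [Module k V] [Module.Finite k V]
  {W : Type u} [AddCommGroup W] [Module k W] [Module.Finite k W] (E : Y.left.Modules)

/-- The section `1 ⊗ v` of `𝒪(V)`. -/
def constSection {V : Type u} [AddCommGroup V] [Module k V] [Module.Finite k V] (v : V)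
    (U : Y.left.Opens) : Γ(freeSheaf Y V, U) :=
  show Γ(Y.left, U) ⊗[k] V from 1 ⊗ₜ v

lemma map_constSection (v : V) {A B : Y.left.Opens} (i : A ⟶ B) :
    (freeSheaf Y V).presheaf.map i.op (constSection v B) = constSection v A :=
  congrArg (· ⊗ₜ[k] v) (map_one (Y.left.presheaf.map i.op).hom)

variable {V} in
/-- The map `e ↦ (1 ⊗ v) ⊗ e`. -/
def tensorInc (v : V) : E ⟶ tensorModules (freeSheaf Y V) E :=
  modulesHomMk (fun U ↦
    { toFun e := pureTensor (constSection v U) e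
      map_add' := pureTensor_add_right _
      map_smul' a e := pureTensor_smul_right a _ e }) fun A B i e ↦ by
    change pureTensor (constSection v A) _ =
      (tensorModules (freeSheaf Y V) E).presheaf.map i.op (pureTensor (constSection v B) e)
    rw [map_pureTensor, map_constSection]

lemma tensorInc_app (v : V) {U : Y.left.Opens} (e : Γ(E, U)) :
    (tensorInc E v).app U e = pureTensor (constSection v U) e := rfl

/-- The coordinate of a section of `𝒪(V)` along a linear form, as a morphism. -/
def coordinateHom (l : V →ₗ[k] k) : freeSheaf Y V ⟶ structureModule Y.left where
  val := PresheafOfModules.homMk (M₁ := tensorPresheaf Y V) (M₂ := (structureModule Y.left).val)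
    { app U := AddCommGrpCat.ofHom (coordinate Y V l U.unop).toAddMonoidHom
      naturality A B i := by
        ext x
        exact coordinate_res Y V l i.unop x }
    (fun U r m ↦ by
      let m' : Γ(Y.left, U.unop) ⊗[k] V := m
      let r' : Γ(Y.left, U.unop) := r
      change coordinate Y V l U.unop (r' • m') = r' * coordinate Y V l U.unop m'
      induction m' using TensorProduct.induction_on with
      | zero => simp
      | tmul a b => simp [coordinate, TensorProduct.smul_tmul']
      | add a b ha hb => simp only [smul_add, map_add, ha, hb, mul_add])

variable {V} in
/-- The map `(s ⊗ v) ⊗ e ↦ l v • s • e`. -/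
def tensorProj (l : V →ₗ[k] k) : tensorModules (freeSheaf Y V) E ⟶ E :=
  tensorModulesDesc (tensorPresheavesMap (coordinateHom V l).val (𝟙 E.val) ≫
    (MonoidalCategory.leftUnitor
      (C := PresheafOfModules.{u} (Y.left.presheaf ⋙ forget₂ CommRingCat RingCat)) E.val).hom)

lemma tensorProj_app (l : V →ₗ[k] k) {U : Y.left.Opens} (s : Γ(freeSheaf Y V, U)) (e : Γ(E, U)) :
    (tensorProj E l).app U (pureTensor s e) =
      (show Γ(Y.left, U) from coordinate Y V l U s) • e :=
  tensorModulesDesc_pureTensor _ _ _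

lemma coordinate_constSection (l : V →ₗ[k] k) (v : V) (U : Y.left.Opens) :
    coordinate Y V l U (constSection v U) = algebraMap k Γ(Y.left, U) (l v) := by
  change coordinate Y V l U ((1 : Γ(Y.left, U)) ⊗ₜ v) = _
  simp [coordinate, Algebra.algebraMap_eq_smul_one]

lemma tensorInc_proj (v : V) (l : V →ₗ[k] k) :
    tensorInc E v ≫ tensorProj E l = scalar E (l v) :=
  modules_hom_ext fun U e ↦ by
    change (tensorProj E l).app U (pureTensor _ _) = _
    rw [tensorProj_app, coordinate_constSection, scalar_app]

lemma tensorInc_map (v : V) (f : V →ₗ[k] W) :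
    tensorInc E v ≫ tensorModulesMap (freeSheafMap Y f) (𝟙 E) = tensorInc E (f v) :=
  modules_hom_ext fun U e ↦ by
    change (tensorModulesMap _ _).app U (pureTensor _ _) = pureTensor _ _
    rw [tensorModulesMap_pureTensor]
    rfl

lemma tensorMap_proj (f : V →ₗ[k] W) (l : W →ₗ[k] k) :
    tensorModulesMap (freeSheafMap Y f) (𝟙 E) ≫ tensorProj E l = tensorProj E (l ∘ₗ f) :=
  tensorModules_hom_ext fun U s e ↦ by
    change (tensorProj E l).app U ((tensorModulesMap _ _).app U (pureTensor _ _)) = _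
    rw [tensorModulesMap_pureTensor, tensorProj_app, tensorProj_app]
    congr 1
    let s' : Γ(Y.left, U) ⊗[k] V := s
    change coordinate Y W l U (f.lTensor _ s') = coordinate Y V (l ∘ₗ f) U s'
    simp [coordinate, LinearMap.lTensor_comp]

lemma sum_tensorProj_inc {ι : Type*} [Fintype ι] (b : Module.Basis ι k V) :
    ∑ i, tensorProj E (b.coord i) ≫ tensorInc E (b i) = 𝟙 (tensorModules (freeSheaf Y V) E) :=
  tensorModules_hom_ext fun U s e ↦ by
    rw [modules_sum_app]
    change ∑ i, (tensorInc E (b i)).app U ((tensorProj E (b.coord i)).app U (pureTensor s e)) =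
      pureTensor s e
    simp only [tensorProj_app, tensorInc_app, pureTensor_smul_right, ← pureTensor_smul_left]
    rw [← pureTensor_sum_left]
    classical
    congr 1
    refine eq_of_coordinate_eq Y V b fun j ↦ ?_
    let s' : Γ(Y.left, U) ⊗[k] V := s
    change coordinate Y V (b.coord j) U (∑ i, coordinate Y V (b.coord i) U s' •
      ((1 : Γ(Y.left, U)) ⊗ₜ[k] b i)) = coordinate Y V (b.coord j) U s'
    simp [coordinate, Finsupp.single_apply, TensorProduct.smul_tmul']

lemma tensorInc_add (v w : V) : tensorInc E (v + w) = tensorInc E v + tensorInc E w :=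
  modules_hom_ext fun U e ↦ by
    change pureTensor _ _ = pureTensor _ _ + pureTensor _ _
    rw [← pureTensor_add_left]
    congr 1
    exact TensorProduct.tmul_add (R := k) (1 : Γ(Y.left, U)) v w

lemma tensorInc_smul (c : k) (v : V) : tensorInc E (c • v) = scalar E c ≫ tensorInc E v :=
  modules_hom_ext fun U e ↦ by
    change pureTensor _ _ = pureTensor _ (algebraMap k Γ(Y.left, U) c • e)
    rw [pureTensor_smul_right, ← pureTensor_smul_left]
    congr 1
    have h : (1 : Γ(Y.left, U)) ⊗ₜ[k] (c • v) =
        algebraMap k Γ(Y.left, U) c • ((1 : Γ(Y.left, U)) ⊗ₜ[k] v) := by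
      rw [TensorProduct.tmul_smul, algebraMap_smul]
    exact h

end
end GaloisCover
end

noncomputable section
namespace GaloisCover

/-! ### The decomposition of an `𝒪_Y[G]`-module -/

/-- A decomposition of an object into a biproduct, from inclusions and projections. -/
def isoOfDecomposition {C : Type*} [Category C] [Preadditive C] [HasFiniteBiproducts C]
    [HasBinaryBiproducts C] {ι : Type} [Fintype ι] {O M : C} {T : ι → C} (c : O ⟶ M)
    (q : M ⟶ O) (Φ : ∀ i, T i ⟶ M)
    (Ψ : ∀ i, M ⟶ T i) (hcq : c ≫ q = 𝟙 O) (hcΨ : ∀ i, c ≫ Ψ i = 0) (hΦq : ∀ i, Φ i ≫ q = 0)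
    (hΦΨ : ∀ i, Φ i ≫ Ψ i = 𝟙 (T i)) (hΦΨ' : ∀ i j, i ≠ j → Φ i ≫ Ψ j = 0)
    (hsum : q ≫ c + ∑ i, Ψ i ≫ Φ i = 𝟙 M) : (O ⊞ ⨁ T) ≅ M where
  hom := biprod.desc c (biproduct.desc Φ)
  inv := biprod.lift q (biproduct.lift Ψ)
  hom_inv_id := by
    ext i j
    · simp [hcq]
    · simp [hcΨ]
    · simp [hΦq]
    · by_cases h : i = j
      · subst h
        simp [hΦΨ]
      · simp [hΦΨ' i j h, biproduct.ι_π_ne _ h]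
  inv_hom_id := by
    rw [biprod.lift_desc, biproduct.lift_desc, hsum]

lemma action_sum_hom {C : Type*} [Category C] [Preadditive C] {G : Type*} [Monoid G]
    {M N : Action C G} {ι : Type*} (s : Finset ι) (f : ι → (M ⟶ N)) :
    (∑ i ∈ s, f i).hom = ∑ i ∈ s, (f i).hom := by
  classical
  induction s using Finset.induction_on with
  | empty => simp
  | insert i s hi ih => rw [Finset.sum_insert hi, Finset.sum_insert hi, ← ih]; rfl

variable {k : Type u} [Field k]

attribute [local instance] algebraSections algebraEnd

variable {Y : Over (Spec (.of k))} {G : Type v} [Group G]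

/-- The action of an element of the group algebra as a morphism. -/
abbrev act (M : Action Y.left.Modules G) (a : MonoidAlgebra k G) : M.V ⟶ M.V :=
  groupAlgebraAction M a

lemma act_comp_act (M : Action Y.left.Modules G) (a b : MonoidAlgebra k G) :
    act M a ≫ act M b = act M (b * a) := (map_mul (groupAlgebraAction M) b a).symm

lemma act_sum (M : Action Y.left.Modules G) {ι : Type*} (s : Finset ι) (a : ι → MonoidAlgebra k G) :
    act M (∑ i ∈ s, a i) = ∑ i ∈ s, act M (a i) := map_sum (groupAlgebraAction M) a s

lemma act_zero (M : Action Y.left.Modules G) : act M (0 : MonoidAlgebra k G) = 0 :=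
  map_zero (groupAlgebraAction M)

lemma act_one (M : Action Y.left.Modules G) : act M (1 : MonoidAlgebra k G) = 𝟙 M.V :=
  map_one (groupAlgebraAction M)

lemma act_smul (M : Action Y.left.Modules G) (c : k) (a : MonoidAlgebra k G) :
    act M (c • a) = scalar M.V c ≫ act M a := by
  rw [scalar_comp]
  exact (map_smul (groupAlgebraAction M) c a).trans (end_smul_eq _ _)

lemma act_of (M : Action Y.left.Modules G) (g : G) :
    act M (MonoidAlgebra.of k G g) = M.ρ g := groupAlgebraAction_of M g

section

variable {ι : Type*} [Fintype ι] {V : ι → FDRep k G} (μ : MatrixUnits V)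
  (M : Action Y.left.Modules G) {i : ι} (z : Fin (Module.finrank k (V i))) {E : Y.left.Modules}
  (inc : E ⟶ M.V) (pr : M.V ⟶ E)

lemma tensorProj_sum (E : Y.left.Modules) {W : Type u} [AddCommGroup W] [Module k W]
    [Module.Finite k W] {κ : Type*} (s : Finset κ) (c : κ → k) (l : κ → (W →ₗ[k] k)) :
    tensorProj E (∑ j ∈ s, c j • l j) = ∑ j ∈ s, tensorProj E (l j) ≫ scalar E (c j) :=
  tensorModules_hom_ext fun U w e ↦ by
    rw [modules_sum_app, tensorProj_app]
    change _ = ∑ j ∈ s, (scalar E (c j)).app U ((tensorProj E (l j)).app U (pureTensor w e))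
    simp only [tensorProj_app, scalar_app, ← mul_smul, ← Finset.sum_smul]
    congr 1
    let w' : Γ(Y.left, U) ⊗[k] W := w
    change coordinate Y W (∑ j ∈ s, c j • l j) U w' =
      ∑ j ∈ s, algebraMap k Γ(Y.left, U) (c j) * coordinate Y W (l j) U w'
    simp only [coordinate, LinearMap.comp_apply, LinearEquiv.coe_coe, ← Algebra.smul_def]
    rw [show (∑ j ∈ s, c j • l j).lTensor Γ(Y.left, U) =
      ∑ j ∈ s, c j • (l j).lTensor Γ(Y.left, U) by
        rw [← LinearMap.coe_lTensorHom]; simp]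
    simp

lemma tensorInc_sum (E : Y.left.Modules) {W : Type u} [AddCommGroup W] [Module k W]
    [Module.Finite k W] {κ : Type*} (s : Finset κ) (c : κ → k) (w : κ → W) :
    tensorInc E (∑ j ∈ s, c j • w j) = ∑ j ∈ s, scalar E (c j) ≫ tensorInc E (w j) := by
  simp only [← tensorInc_smul]
  let φ : W →+ (E ⟶ tensorModules (freeSheaf Y W) E) := AddMonoidHom.mk' (tensorInc E)
    (tensorInc_add W E)
  exact map_sum φ _ s

lemma ρ_basis_eq (V : FDRep k G) (g : G) (m : Fin (Module.finrank k V)) :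
    V.ρ g (Module.finBasis k V m) = ∑ j, (Module.finBasis k V).coord j
      (V.ρ g (Module.finBasis k V m)) • Module.finBasis k V j :=
  ((Module.finBasis k V).sum_repr _).symm

lemma coord_comp_ρ (V : FDRep k G) (g : G) (l : Fin (Module.finrank k V)) :
    (Module.finBasis k V).coord l ∘ₗ V.ρ g = ∑ m, (Module.finBasis k V).coord l
      (V.ρ g (Module.finBasis k V m)) • (Module.finBasis k V).coord m := by
  refine (Module.finBasis k V).ext fun m ↦ ?_
  simp [Finsupp.single_apply]

variable (i) in
/-- The evaluation map `𝒪(V_i) ⊗ E → M`, as a morphism of `𝒪_Y`-modules. -/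
def isotypicIncHom : tensorModules (freeSheaf Y (V i)) E ⟶ M.V :=
  ∑ j, tensorProj E ((Module.finBasis k (V i)).coord j) ≫ inc ≫ act M (μ.unit i j z)

variable (i) in
/-- The coefficient map `M → 𝒪(V_i) ⊗ E`, as a morphism of `𝒪_Y`-modules. -/
def isotypicProjHom : M.V ⟶ tensorModules (freeSheaf Y (V i)) E :=
  ∑ j, act M (μ.unit i z j) ≫ pr ≫ tensorInc E (Module.finBasis k (V i) j)

lemma isotypicIncHom_comm (g : G) :
    tensorModulesMap (freeSheafMap Y ((V i).ρ g)) (𝟙 E) ≫ isotypicIncHom μ M i z inc =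
      isotypicIncHom μ M i z inc ≫ M.ρ g := by
  rw [isotypicIncHom, Preadditive.comp_sum, Preadditive.sum_comp]
  simp only [reassoc_of% (tensorMap_proj (Y := Y)), coord_comp_ρ, tensorProj_sum,
    Preadditive.sum_comp, Category.assoc, ← act_of, act_comp_act, μ.of_mul_unit, act_sum, act_smul,
    Preadditive.comp_sum]
  rw [Finset.sum_comm]
  simp only [reassoc_of% (scalar_comp (k := k) (Y := Y))]

lemma isotypicProjHom_comm (g : G) :
    M.ρ g ≫ isotypicProjHom μ M i z pr =
      isotypicProjHom μ M i z pr ≫ tensorModulesMap (freeSheafMap Y ((V i).ρ g)) (𝟙 E) := by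
  rw [isotypicProjHom, Preadditive.comp_sum, Preadditive.sum_comp]
  simp only [Category.assoc, tensorInc_map, ← act_of, reassoc_of% act_comp_act,
    μ.unit_mul_of, act_sum, act_smul, Preadditive.sum_comp]
  rw [Finset.sum_comm]
  refine Finset.sum_congr rfl fun m _ ↦ ?_
  conv_rhs => rw [ρ_basis_eq, tensorInc_sum, Preadditive.comp_sum, Preadditive.comp_sum]
  simp only [reassoc_of% (scalar_comp (k := k) (Y := Y))]

variable (i) in
/-- The evaluation map `𝒪(V_i) ⊗ E → M`. -/
def isotypicInc : isotypicModule Y (V i) E ⟶ M where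
  hom := isotypicIncHom μ M i z inc
  comm := isotypicIncHom_comm μ M z inc

variable (i) in
/-- The coefficient map `M → 𝒪(V_i) ⊗ E`. -/
def isotypicProj : M ⟶ isotypicModule Y (V i) E where
  hom := isotypicProjHom μ M i z pr
  comm := isotypicProjHom_comm μ M z pr

lemma isotypicIncHom_proj (h₁ : inc ≫ pr = 𝟙 E) (h₂ : pr ≫ inc = act M (μ.unit i z z)) :
    isotypicIncHom μ M i z inc ≫ isotypicProjHom μ M i z pr = 𝟙 _ := by
  have h₃ : inc ≫ act M (μ.unit i z z) ≫ pr = 𝟙 E := by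
    rw [← h₂, Category.assoc, h₁, Category.comp_id, h₁]
  rw [isotypicIncHom, isotypicProjHom, ← sum_tensorProj_inc (V i) E (Module.finBasis k (V i)),
    Preadditive.sum_comp]
  refine Finset.sum_congr rfl fun j _ ↦ ?_
  rw [Preadditive.comp_sum, Finset.sum_eq_single j]
  · simp only [Category.assoc, reassoc_of% act_comp_act, μ.unit_mul_unit, reassoc_of% h₃]
  · intro l _ hl
    simp only [Category.assoc, reassoc_of% act_comp_act, μ.unit_mul_unit_of_ne _ _ _ _ _ hl,
      act_zero, zero_comp, comp_zero]
  · simp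

lemma isotypicProjHom_inc (h₂ : pr ≫ inc = act M (μ.unit i z z)) :
    isotypicProjHom μ M i z pr ≫ isotypicIncHom μ M i z inc = ∑ j, act M (μ.unit i j j) := by
  rw [isotypicIncHom, isotypicProjHom, Preadditive.sum_comp]
  refine Finset.sum_congr rfl fun j _ ↦ ?_
  rw [Preadditive.comp_sum, Finset.sum_eq_single j]
  · simp only [Category.assoc, reassoc_of% tensorInc_proj]
    rw [Module.Basis.coord_apply, Module.Basis.repr_self, Finsupp.single_eq_same,
      show scalar E (1 : k) = 𝟙 E from map_one (algebraMap k (End E)), Category.id_comp,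
      reassoc_of% h₂, act_comp_act, act_comp_act, μ.unit_mul_unit, μ.unit_mul_unit]
  · intro l _ hl
    simp only [Category.assoc, reassoc_of% tensorInc_proj]
    rw [Module.Basis.coord_apply, Module.Basis.repr_self, Finsupp.single_eq_of_ne hl,
      show scalar E (0 : k) = 0 from map_zero (algebraMap k (End E)), zero_comp, comp_zero,
      comp_zero]
  · simp

lemma isotypicIncHom_proj_of_ne {i' : ι} (z' : Fin (Module.finrank k (V i')))
    {E' : Y.left.Modules} (pr' : M.V ⟶ E') (h : i ≠ i') :
    isotypicIncHom μ M i z inc ≫ isotypicProjHom μ M i' z' pr' = 0 := by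
  rw [isotypicIncHom, isotypicProjHom, Preadditive.sum_comp]
  refine Finset.sum_eq_zero fun j _ ↦ ?_
  rw [Preadditive.comp_sum]
  refine Finset.sum_eq_zero fun l _ ↦ ?_
  simp only [Category.assoc, reassoc_of% act_comp_act,
    μ.unit_mul_unit_of_index_ne _ _ _ _ _ _ h.symm, act_zero, zero_comp, comp_zero]

lemma isotypicInc_proj (h₁ : inc ≫ pr = 𝟙 E) (h₂ : pr ≫ inc = act M (μ.unit i z z)) :
    isotypicInc μ M i z inc ≫ isotypicProj μ M i z pr = 𝟙 _ :=
  Action.Hom.ext (isotypicIncHom_proj μ M z inc pr h₁ h₂)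

lemma isotypicInc_proj_of_ne {i' : ι} (z' : Fin (Module.finrank k (V i')))
    {E' : Y.left.Modules} (pr' : M.V ⟶ E') (h : i ≠ i') :
    isotypicInc μ M i z inc ≫ isotypicProj μ M i' z' pr' = 0 :=
  Action.Hom.ext (isotypicIncHom_proj_of_ne μ M z inc z' pr' h)

lemma isotypicProj_inc_hom (h₂ : pr ≫ inc = act M (μ.unit i z z)) :
    (isotypicProj μ M i z pr ≫ isotypicInc μ M i z inc).hom = ∑ j, act M (μ.unit i j j) :=
  isotypicProjHom_inc μ M z inc pr h₂

end
end GaloisCover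
end

noncomputable section
namespace GaloisCover

/-! ### The trivial isotypic component -/

section

variable {k : Type u} [Field k] {G : Type v} [Group G] {ι : Type*} [Fintype ι]
  {V : ι → FDRep k G} (μ : MatrixUnits V) {i : ι}

lemma of_mul_unit_of_trivial (hi : ∀ g v, (V i).ρ g v = v) (g : G)
    (m l : Fin (Module.finrank k (V i))) :
    MonoidAlgebra.of k G g * μ.unit i m l = μ.unit i m l := by
  rw [μ.of_mul_unit, Finset.sum_eq_single m]
  · simp [hi]
  · intro j _ hj
    simp [hi, hj]
  · simp

lemma augmentation_unit_of_trivial (hi : ∀ g v, (V i).ρ g v = v)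
    (z : Fin (Module.finrank k (V i))) : MonoidAlgebra.lift k k G 1 (μ.unit i z z) = 1 := by
  have h (a : MonoidAlgebra k G) :
      a * μ.unit i z z = MonoidAlgebra.lift k k G 1 a • μ.unit i z z := by
    induction a using MonoidAlgebra.induction_on with
    | of g => rw [of_mul_unit_of_trivial μ hi, MonoidAlgebra.lift_of]; simp
    | add a b ha hb => rw [add_mul, ha, hb, map_add, add_smul]
    | smul c a ha => rw [smul_mul_assoc, ha, map_smul, smul_smul, smul_eq_mul]
  have h' := (μ.unit_mul_unit i z z z).symm.trans (h _)
  have h'' : (MonoidAlgebra.lift k k G 1 (μ.unit i z z) - 1) • μ.unit i z z = 0 := by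
    rw [sub_smul, one_smul, ← h', sub_self]
  exact sub_eq_zero.mp ((smul_eq_zero.mp h'').resolve_right (μ.unit_ne_zero i z z))

lemma ρ_eq_of_iso_trivial {W : FDRep k G}
    (e : W ≅ FDRep.of (Representation.trivial k G k)) (g : G) (w : W) : W.ρ g w = w := by
  have h (w : W) : fdRepLin e.inv (fdRepLin e.hom w) = w :=
    congrArg (fun φ : W ⟶ W ↦ fdRepLin φ w) e.hom_inv_id
  have h' : fdRepLin e.hom (W.ρ g w) = fdRepLin e.hom w := fdRepLin_ρ e.hom g w
  rw [← h (W.ρ g w), h', h]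

lemma finrank_of_iso_trivial {W : FDRep k G}
    (e : W ≅ FDRep.of (Representation.trivial k G k)) : Module.finrank k W = 1 := by
  have e' : W ≃ₗ[k] k :=
    { fdRepLin e.hom with
      invFun := fdRepLin e.inv
      left_inv := fun v ↦ congrArg (fun φ : W ⟶ W ↦ fdRepLin φ v) e.hom_inv_id
      right_inv := fun v ↦ congrArg (fun φ : FDRep.of (Representation.trivial k G k) ⟶
        FDRep.of (Representation.trivial k G k) ↦ fdRepLin φ v) e.inv_hom_id }
  rw [e'.finrank_eq, Module.finrank_self]

end

variable {k : Type u} [Field k]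

attribute [local instance] algebraSections algebraEnd

variable {Y : Over (Spec (.of k))} {G : Type v} [Group G]

lemma act_augmentation (M : Action Y.left.Modules G) {F : Y.left.Modules}
    (c : F ⟶ M.V) (hc : ∀ g, c ≫ M.ρ g = c) {a : MonoidAlgebra k G}
    (ha : MonoidAlgebra.lift k k G 1 a = 1) : c ≫ act M a = c := by
  refine (comp_groupAlgebraAction_of_invariant M c hc a).trans ?_
  rw [ha, show scalar M.V (1 : k) = 𝟙 M.V from map_one (algebraMap k (End M.V)), Category.comp_id]

section

variable {ι : Type*} [Fintype ι] {V : ι → FDRep k G} (μ : MatrixUnits V)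
  (M : Action Y.left.Modules G) {F : Y.left.Modules} (c : F ⟶ M.V) (hc : ∀ g, c ≫ M.ρ g = c)
  (hinj : ∀ U : Y.left.Opens, Function.Injective (c.app U))
  (hinv : ∀ (U : Y.left.Opens) (m : Γ(M.V, U)), (∀ g, (M.ρ g).app U m = m) →
    ∃ t : Γ(F, U), c.app U t = m)
  {i : ι} (hi : ∀ g v, (V i).ρ g v = v) (z : Fin (Module.finrank k (V i)))

include hc hinj hinv hi in
/-- The projector to the trivial isotypic component factors through the invariants. -/
lemma exists_retraction_of_trivial :
    ∃ q : M.V ⟶ F, c ≫ q = 𝟙 F ∧ q ≫ c = act M (μ.unit i z z) := by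
  obtain ⟨E, inc, pr, h₁, h₂⟩ := IsIdempotentComplete.idempotents_split M.V
    (act M (μ.unit i z z)) ((act_comp_act M _ _).trans (by rw [μ.unit_mul_unit]))
  have hcact : c ≫ act M (μ.unit i z z) = c :=
    act_augmentation M c hc (augmentation_unit_of_trivial μ hi z)
  have hcpi : (c ≫ pr) ≫ inc = c := by rw [Category.assoc, h₂, hcact]
  have hiso : IsIso (c ≫ pr) := by
    rw [Scheme.Modules.Hom.isIso_iff_isIso_app]
    intro U
    rw [ConcreteCategory.isIso_iff_bijective]
    refine ⟨fun s t hst ↦ hinj U ?_, fun e ↦ ?_⟩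
    · have h := congrArg (inc.app U) hst
      rw [← hcpi]
      exact h
    · obtain ⟨t, ht⟩ := hinv U (inc.app U e) fun g ↦ by
        have h : inc ≫ M.ρ g = inc := by
          have h' : inc = inc ≫ act M (μ.unit i z z) := by
            rw [← h₂, reassoc_of% h₁]
          conv_lhs => rw [h']
          rw [Category.assoc, ← act_of, act_comp_act, of_mul_unit_of_trivial μ hi, ← h']
        exact congrArg (fun f : E ⟶ M.V ↦ f.app U e) h
      refine ⟨t, ?_⟩
      change pr.app U (c.app U t) = e
      rw [ht]
      exact congrArg (fun f : E ⟶ E ↦ f.app U e) h₁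
  refine ⟨pr ≫ inv (c ≫ pr), ?_, ?_⟩
  · rw [← Category.assoc, IsIso.hom_inv_id]
  · rw [← h₂, Category.assoc]
    congr 1
    rw [IsIso.inv_comp_eq, hcpi]

end

lemma isotypicProj_comp_of_invariant {ι : Type*} [Fintype ι] {V : ι → FDRep k G}
    (μ : MatrixUnits V) (M : Action Y.left.Modules G) {F : Y.left.Modules} (c : F ⟶ M.V)
    {i₀ i : ι} (z₀ : Fin (Module.finrank k (V i₀)))
    (hcact : c ≫ act M (μ.unit i₀ z₀ z₀) = c) (z : Fin (Module.finrank k (V i)))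
    {E : Y.left.Modules} (pr : M.V ⟶ E) (h : i₀ ≠ i) : c ≫ isotypicProjHom μ M i z pr = 0 := by
  rw [isotypicProjHom, Preadditive.comp_sum]
  refine Finset.sum_eq_zero fun j _ ↦ ?_
  rw [← hcact, Category.assoc, reassoc_of% act_comp_act,
    μ.unit_mul_unit_of_index_ne _ _ _ _ _ _ h.symm, act_zero, zero_comp, comp_zero]

/-- The decomposition of an `𝒪_Y[G]`-module with invariants `𝒪_Y`. -/
theorem exists_decomposition {r : ℕ} {V : Fin (r + 1) → FDRep k G} (μ : MatrixUnits V)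
    (z : ∀ i, Fin (Module.finrank k (V i)))
    (hV_zero : Nonempty (V 0 ≅ FDRep.of (Representation.trivial k G k)))
    (M : Action Y.left.Modules G) (c : structureModule Y.left ⟶ M.V) (hc : ∀ g, c ≫ M.ρ g = c)
    (hinj : ∀ U : Y.left.Opens, Function.Injective (c.app U))
    (hinv : ∀ (U : Y.left.Opens) (m : Γ(M.V, U)), (∀ g, (M.ρ g).app U m = m) →
      ∃ t : Γ(structureModule Y.left, U), c.app U t = m)
    (E : Fin r → Y.left.Modules) (inc : ∀ i, E i ⟶ M.V) (pr : ∀ i, M.V ⟶ E i)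
    (h₁ : ∀ i, inc i ≫ pr i = 𝟙 (E i))
    (h₂ : ∀ i, pr i ≫ inc i = act M (μ.unit i.succ (z i.succ) (z i.succ))) :
    ∃ φ : (Action.trivial G (structureModule Y.left) ⊞
          ⨁ fun i : Fin r ↦ isotypicModule Y (V i.succ) (E i)) ≅ M,
      ((biprod.inl :
          Action.trivial G (structureModule Y.left) ⟶ Action.trivial G (structureModule Y.left) ⊞
            ⨁ fun i : Fin r ↦ isotypicModule Y (V i.succ) (E i)) ≫ φ.hom).hom = c := by
  obtain ⟨e⟩ := hV_zero
  have hi := ρ_eq_of_iso_trivial e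
  have : Subsingleton (Fin (Module.finrank k (V 0))) :=
    Fin.subsingleton_iff_le_one.mpr (finrank_of_iso_trivial e).le
  obtain ⟨q, hcq, hqc⟩ := exists_retraction_of_trivial μ M c hc hinj hinv hi (z 0)
  have hcact : c ≫ act M (μ.unit 0 (z 0) (z 0)) = c := by rw [← hqc, reassoc_of% hcq]
  have hqρ (g : G) : M.ρ g ≫ q = q := by
    have h : (M.ρ g ≫ q) ≫ c = q ≫ c := by
      rw [Category.assoc, hqc, ← act_of, act_comp_act, μ.unit_mul_of]
      rw [Finset.sum_eq_single (z 0)]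
      · simp [hi]
      · exact fun j _ hj ↦ (hj (Subsingleton.elim _ _)).elim
      · simp
    have h' := congrArg (· ≫ q) h
    simpa only [Category.assoc, hcq, Category.comp_id] using h'
  let c' : Action.trivial G (structureModule Y.left) ⟶ M :=
    { hom := c
      comm := fun g ↦ (Category.id_comp _).trans (hc g).symm }
  let q' : M ⟶ Action.trivial G (structureModule Y.left) :=
    { hom := q
      comm := fun g ↦ (hqρ g).trans (Category.comp_id _).symm }
  let φ := isoOfDecomposition c' q' (fun i : Fin r ↦ isotypicInc μ M i.succ (z i.succ) (inc i))
    (fun i : Fin r ↦ isotypicProj μ M i.succ (z i.succ) (pr i))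
    (Action.Hom.ext hcq)
    (fun i ↦ Action.Hom.ext (isotypicProj_comp_of_invariant μ M c (z 0) hcact (z i.succ) (pr i)
      (Fin.succ_ne_zero i).symm))
    (fun i ↦ Action.Hom.ext (by
      change isotypicIncHom μ M i.succ (z i.succ) (inc i) ≫ q = 0
      have h : (isotypicIncHom μ M i.succ (z i.succ) (inc i) ≫ q) ≫ c = 0 := by
        rw [Category.assoc, hqc, isotypicIncHom, Preadditive.sum_comp]
        refine Finset.sum_eq_zero fun j _ ↦ ?_
        rw [Category.assoc, Category.assoc, act_comp_act, μ.unit_mul_unit_of_index_ne _ _ _ _ _ _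
          (Fin.succ_ne_zero i).symm, act_zero, comp_zero, comp_zero]
      have h' := congrArg (· ≫ q) h
      simpa only [Category.assoc, hcq, Category.comp_id, zero_comp] using h'))
    (fun i ↦ isotypicInc_proj μ M (z i.succ) (inc i) (pr i) (h₁ i) (h₂ i))
    (fun i j hij ↦ isotypicInc_proj_of_ne μ M (z i.succ) (inc i) (z j.succ) (pr j)
      fun h ↦ hij (Fin.succ_injective r h))
    (Action.Hom.ext (by
      rw [Action.add_hom, action_sum_hom]
      simp only [isotypicProj_inc_hom μ M _ _ _ (h₂ _)]
      change q ≫ c + _ = 𝟙 M.V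
      rw [hqc, ← act_one, ← μ.sum_unit, act_sum, Fin.sum_univ_succ]
      simp only [act_sum]
      congr 1
      rw [Finset.sum_eq_single (z 0) (fun j _ hj ↦ (hj (Subsingleton.elim _ _)).elim) (by simp)]))
  refine ⟨φ, ?_⟩
  have h : (biprod.inl : Action.trivial G (structureModule Y.left) ⟶ _) ≫ φ.hom = c' :=
    biprod.inl_desc _ _
  rw [h]

/-- Invariance of the comorphism of a quotient. -/
lemma comorphism_comp_ρ {X : Over (Spec (.of k))} (a : G →* Aut X) (π : X ⟶ Y)
    (h : ∀ g, (a g).hom ≫ π = π) (g : G) :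
    comorphism π.left ≫ (pushforwardModule a π h).ρ g = comorphism π.left :=
  modules_hom_ext fun U s ↦ by
    change (a g⁻¹).hom.left.appLE (π.left ⁻¹ᵁ U) (π.left ⁻¹ᵁ U) _ (π.left.app U s) = π.left.app U s
    have h' := congrArg CommaMorphism.left (h g⁻¹)
    have key : π.left.app U ≫ (a g⁻¹).hom.left.appLE (π.left ⁻¹ᵁ U) (π.left ⁻¹ᵁ U)
        (le_preimage h' U) = π.left.app U := by
      rw [Scheme.Hom.app_eq_appLE, Scheme.Hom.appLE_comp_appLE]
      congr 1
    exact congrArg (fun f : Γ(Y.left, U) ⟶ Γ(X.left, π.left ⁻¹ᵁ U) ↦ f s) key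

end GaloisCover
end

noncomputable section
namespace GaloisCover

/-! ### A quotient by a finite group is a finite morphism -/

section

variable {k : Type u} [Field k] {X Y : Over (Spec (.of k))} {G : Type v} [Group G]

lemma left_comp_eq {a : G →* Aut X} {π : X ⟶ Y} (h : ∀ g, (a g).hom ≫ π = π) (g : G) :
    (a g).hom.left ≫ π.left = π.left := congrArg CommaMorphism.left (h g)

/-- Pulling back functions along the automorphism of an element of `G`. -/
def pullbackHom (a : G →* Aut X) (π : X ⟶ Y) (h : ∀ g, (a g).hom ≫ π = π) (U : Y.left.Opens)
    (g : G) : Γ(X.left, π.left ⁻¹ᵁ U) ⟶ Γ(X.left, π.left ⁻¹ᵁ U) :=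
  (a g).hom.left.appLE (π.left ⁻¹ᵁ U) (π.left ⁻¹ᵁ U) (le_preimage (left_comp_eq h g) U)

/-- The action of `G` on the functions on the preimage of an open subset. -/
@[reducible] def sectionsAction (a : G →* Aut X) (π : X ⟶ Y) (h : ∀ g, (a g).hom ≫ π = π)
    (U : Y.left.Opens) : MulSemiringAction G Γ(X.left, π.left ⁻¹ᵁ U) where
  smul g s := pullbackHom a π h U g⁻¹ s
  one_smul s := congrArg (fun f : (pushforwardModule a π h).V ⟶ _ ↦ f.app U s)
    (pushforwardModule a π h).ρ.map_one
  mul_smul g g' s := congrArg (fun f : (pushforwardModule a π h).V ⟶ _ ↦ f.app U s)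
    ((pushforwardModule a π h).ρ.map_mul g g')
  smul_zero g := map_zero (pullbackHom a π h U g⁻¹).hom
  smul_add g := map_add (pullbackHom a π h U g⁻¹).hom
  smul_one g := map_one (pullbackHom a π h U g⁻¹).hom
  smul_mul g := map_mul (pullbackHom a π h U g⁻¹).hom

/-- Functions on the preimage of an open subset form an algebra over the functions on it. -/
@[reducible] def preimageAlgebra {S T : Scheme.{u}} (f : S ⟶ T) (U : T.Opens) :
    Algebra Γ(T, U) Γ(S, f ⁻¹ᵁ U) :=
  (f.app U).hom.toAlgebra

attribute [local instance] preimageAlgebra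

lemma app_pullbackHom (a : G →* Aut X) (π : X ⟶ Y) (h : ∀ g, (a g).hom ≫ π = π)
    (U : Y.left.Opens) (g : G) (s : Γ(Y.left, U)) :
    pullbackHom a π h U g (π.left.app U s) = π.left.app U s := by
  have h' := congrArg (fun f : structureModule Y.left ⟶ _ ↦ f.app U s)
    (comorphism_comp_ρ a π h g⁻¹)
  change pullbackHom a π h U g⁻¹⁻¹ (π.left.app U s) = π.left.app U s at h'
  rwa [inv_inv] at h'

variable {a : G →* Aut X} {π : X ⟶ Y} (hπ : IsQuotient a π)

include hπ

lemma IsQuotient.isInvariant (U : Y.left.Opens) :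
    letI := sectionsAction a π hπ.invariant U
    Algebra.IsInvariant Γ(Y.left, U) Γ(X.left, π.left ⁻¹ᵁ U) G :=
  letI := sectionsAction a π hπ.invariant U
  ⟨fun s hs ↦ hπ.exists_of_invariant U s fun g ↦ by
    have h := hs g⁻¹
    change pullbackHom a π hπ.invariant U g⁻¹⁻¹ s = s at h
    rwa [inv_inv] at h⟩

lemma IsQuotient.smulCommClass (U : Y.left.Opens) :
    letI := sectionsAction a π hπ.invariant U
    SMulCommClass G Γ(Y.left, U) Γ(X.left, π.left ⁻¹ᵁ U) :=
  letI := sectionsAction a π hπ.invariant U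
  ⟨fun g r s ↦ by
    rw [Algebra.smul_def, Algebra.smul_def, MulSemiringAction.smul_mul]
    congr 1
    exact app_pullbackHom a π hπ.invariant U g⁻¹ r⟩

lemma IsQuotient.finite_preimage_singleton [Finite G] (y : Y.left) :
    (π.left ⁻¹' {y}).Finite := by
  rcases (π.left ⁻¹' {y}).eq_empty_or_nonempty with h | ⟨x, hx⟩
  · rw [h]; exact Set.finite_empty
  · refine (Set.finite_range fun g ↦ (a g).hom.left x).subset fun x' hx' ↦ ?_
    exact hπ.exists_of_eq x x' (hx.trans hx'.symm)

lemma IsQuotient.surjective_toSpecΓ [Finite G] {U : Y.left.Opens} (hU : IsAffineOpen U) :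
    Function.Surjective (π.left ⁻¹ᵁ U).toSpecΓ := by
  let _ := sectionsAction a π hπ.invariant U
  have := hπ.isInvariant U
  have := hπ.smulCommClass U
  intro q
  obtain ⟨x, hx⟩ := hπ.isQuotientMap.surjective
    (hU.isoSpec.inv (Spec.map (π.left.app U) q)).1
  have hxU : x ∈ π.left ⁻¹ᵁ U := by
    change π.left x ∈ U
    rw [hx]
    exact (hU.isoSpec.inv (Spec.map (π.left.app U) q)).2
  let w : (π.left ⁻¹ᵁ U).toScheme := ⟨x, hxU⟩
  have h1 : Spec.map (π.left.app U) ((π.left ⁻¹ᵁ U).toSpecΓ w) = Spec.map (π.left.app U) q := by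
    rw [← Scheme.Hom.comp_apply, Scheme.Opens.toSpecΓ_naturality, Scheme.Hom.comp_apply]
    have h2 : (π.left ∣_ U) w = hU.isoSpec.inv (Spec.map (π.left.app U) q) :=
      Subtype.ext ((morphismRestrict_base_coe π.left U w).trans hx)
    rw [h2, ← Scheme.Hom.comp_apply, hU.isoSpec_inv_toSpecΓ]
    rfl
  have hw : ((π.left ⁻¹ᵁ U).toSpecΓ w).asIdeal.IsPrime := PrimeSpectrum.isPrime _
  have hq : q.asIdeal.IsPrime := PrimeSpectrum.isPrime _
  obtain ⟨g, hg⟩ := Algebra.IsInvariant.exists_smul_of_under_eq Γ(Y.left, U) _ G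
    ((π.left ⁻¹ᵁ U).toSpecΓ w).asIdeal q.asIdeal (congrArg PrimeSpectrum.asIdeal h1)
  refine ⟨(a g).hom.left.resLE _ _ (le_preimage (left_comp_eq hπ.invariant g) U) w, ?_⟩
  rw [← Scheme.Hom.comp_apply, ← Scheme.Opens.toSpecΓ_SpecMap_appLE, Scheme.Hom.comp_apply]
  refine PrimeSpectrum.ext ?_
  rw [hg, Ideal.pointwise_smul_eq_comap]
  ext s
  change pullbackHom a π hπ.invariant U g s ∈ ((π.left ⁻¹ᵁ U).toSpecΓ w).asIdeal ↔
    pullbackHom a π hπ.invariant U g⁻¹⁻¹ s ∈ ((π.left ⁻¹ᵁ U).toSpecΓ w).asIdeal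
  rw [inv_inv]

variable [IsVariety X]

omit hπ in
lemma locallyOfFiniteType_left (π : X ⟶ Y) : LocallyOfFiniteType π.left :=
  have : LocallyOfFiniteType (π.left ≫ Y.hom) := by rw [Over.w]; infer_instance
  locallyOfFiniteType_of_comp _ Y.hom

omit hπ in
lemma isSeparated_left (π : X ⟶ Y) : IsSeparated π.left :=
  have : IsSeparated (π.left ≫ Y.hom) := by rw [Over.w]; infer_instance
  .of_comp _ Y.hom

omit hπ in
lemma quasiCompact_left [IsVariety Y] (π : X ⟶ Y) : QuasiCompact π.left :=
  have : QuasiCompact (π.left ≫ Y.hom) := by rw [Over.w]; infer_instance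
  .of_comp _ Y.hom

lemma IsQuotient.isAffineOpen_preimage [IsVariety Y] [Finite G] {U : Y.left.Opens}
    (hU : IsAffineOpen U) : IsAffineOpen (π.left ⁻¹ᵁ U) := by
  have := locallyOfFiniteType_left π
  have := isSeparated_left π
  have := quasiCompact_left π
  have : LocallyQuasiFinite π.left :=
    .of_finite_preimage_singleton _ hπ.finite_preimage_singleton
  have hN : IsAffineOpen (π.left.fromNormalization ⁻¹ᵁ U) := hU.preimage _
  have : IsAffine (π.left.fromNormalization ⁻¹ᵁ U).toScheme := hN
  have : CompactSpace (π.left ⁻¹ᵁ U).toScheme :=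
    isCompact_iff_compactSpace.mp (π.left.isCompact_preimage hU.isCompact)
  have hle : π.left ⁻¹ᵁ U ≤ π.left.toNormalization ⁻¹ᵁ (π.left.fromNormalization ⁻¹ᵁ U) := by
    rw [← Scheme.Hom.comp_preimage, π.left.toNormalization_fromNormalization]
  have : IsImmersion (π.left.toNormalization.resLE (π.left.fromNormalization ⁻¹ᵁ U)
    (π.left ⁻¹ᵁ U) hle) := inferInstance
  have : (π.left ⁻¹ᵁ U).toScheme.IsQuasiAffine := .of_isImmersion
    (π.left.toNormalization.resLE (π.left.fromNormalization ⁻¹ᵁ U) (π.left ⁻¹ᵁ U) hle)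
  have : IsOpenImmersion (π.left ⁻¹ᵁ U).toSpecΓ := by
    rw [Scheme.Opens.toSpecΓ]; infer_instance
  have : Surjective (π.left ⁻¹ᵁ U).toSpecΓ := ⟨hπ.surjective_toSpecΓ hU⟩
  have : IsIso (π.left ⁻¹ᵁ U).toSpecΓ := IsOpenImmersion.isIso _
  exact .of_isIso (π.left ⁻¹ᵁ U).toSpecΓ

lemma IsQuotient.finite_preimage [IsVariety Y] [Finite G] {U : Y.left.Opens} (hU : IsAffineOpen U) :
    Module.Finite Γ(Y.left, U) Γ(X.left, π.left ⁻¹ᵁ U) := by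
  let _ := sectionsAction a π hπ.invariant U
  have := hπ.isInvariant U
  have := hπ.smulCommClass U
  have := locallyOfFiniteType_left π
  have : Algebra.IsIntegral Γ(Y.left, U) Γ(X.left, π.left ⁻¹ᵁ U) :=
    Algebra.IsInvariant.isIntegral _ _ G
  have : Algebra.FiniteType Γ(Y.left, U) Γ(X.left, π.left ⁻¹ᵁ U) := by
    have h := π.left.finiteType_appLE hU (hπ.isAffineOpen_preimage hU) le_rfl
    rwa [← Scheme.Hom.app_eq_appLE] at h
  exact Algebra.IsIntegral.finite

end

end GaloisCover
end

noncomputable section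
namespace GaloisCover

/-! ### Coherence -/

section

variable {S T : Scheme.{u}}

/-- Transport of a presentation along an isomorphism of `𝒪_S`-modules. -/
def presentationOfIso {M N : S.Modules} (e : M ≅ N)
    (p : SheafOfModules.Presentation (R := S.ringCatSheaf) M) :
    SheafOfModules.Presentation (R := S.ringCatSheaf) N :=
  @SheafOfModules.Presentation.ofIsIso _ _ _ _ _ _ M N e.hom
    ⟨e.inv, e.hom_inv_id, e.inv_hom_id⟩ p

/-- A presentation of the restriction of `M` to `U` gives one of `M.over U`. -/
def presentationOver (M : S.Modules) (U : S.Opens)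
    (p : SheafOfModules.Presentation (R := U.toScheme.ringCatSheaf) (M.restrict U.ι)) :
    SheafOfModules.Presentation (M.over U) := by
  let E : SheafOfModules (S.ringCatSheaf.over U) ≌ SheafOfModules U.toScheme.ringCatSheaf :=
    Scheme.Modules.overEquiv U
  let p' : SheafOfModules.Presentation (E.functor.obj (M.over U)) :=
    presentationOfIso ((Scheme.Modules.overFunctorEquiv U).app M).symm p
  let e : E.functor.obj (SheafOfModules.unit (S.ringCatSheaf.over U)) ≅
      SheafOfModules.unit U.toScheme.ringCatSheaf := by
    let e₀ : Scheme.Modules.restrict (structureModule S) U.ι ≅ structureModule U.toScheme :=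
      Scheme.Modules.restrictUnitIso U.ι
    let e₁ := ((Scheme.Modules.overFunctorEquiv U).app (structureModule S)) ≪≫ e₀
    exact ⟨e₁.hom, e₁.inv, e₁.hom_inv_id, e₁.inv_hom_id⟩
  exact SheafOfModules.Presentation.ofIsIso (E.unitIso.inv.app (M.over U))
    (p'.map E.inverse (E.unitIso.app _ ≪≫ E.inverse.mapIso e))

lemma nonempty_presentation_over (M : S.Modules) {U : S.Opens} (hU : IsAffineOpen U)
    (h : IsIso (M.restrict hU.fromSpec).fromTildeΓ) : Nonempty (M.over U).Presentation := by
  let N : (Spec Γ(S, U)).Modules := M.restrict hU.fromSpec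
  have : IsIso (Scheme.Modules.fromTildeΓ (R := Γ(S, U)) N) := h
  let p₁ : SheafOfModules.Presentation (R := (Spec Γ(S, U)).ringCatSheaf) N :=
    presentationOfIso (asIso (Scheme.Modules.fromTildeΓ (R := Γ(S, U)) N))
      (presentationTilde.{u} _ .univ (by simp) _ (Submodule.span_eq _))
  let e : N.restrict hU.isoSpec.hom ≅ M.restrict U.ι :=
    ((Scheme.Modules.restrictFunctorComp hU.isoSpec.hom hU.fromSpec).symm ≪≫
      Scheme.Modules.restrictFunctorCongr hU.isoSpec_hom_fromSpec).app M
  exact ⟨presentationOver M U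
    (presentationOfIso e (Scheme.Modules.presentationRestrict hU.isoSpec.hom p₁))⟩

/-- A module that is a module of the form `M^~` over every affine open subset is quasi-coherent. -/
theorem isQuasicoherent_of_isIso_fromTildeΓ (M : S.Modules)
    (h : ∀ (U : S.Opens) (hU : IsAffineOpen U), IsIso (M.restrict hU.fromSpec).fromTildeΓ) :
    M.IsQuasicoherent := by
  refine SheafOfModules.QuasicoherentData.isQuasicoherent (M := M)
    { I := S.affineOpens
      X := fun U ↦ U.1
      coversTop := ?_
      presentation := fun U ↦ (nonempty_presentation_over M U.2 (h U.1 U.2)).some }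
  rw [Opens.coversTop_iff]
  exact iSup_affineOpens_eq_top S

lemma isIso_fromTildeΓ_of_retract {R : CommRingCat.{u}} {M N : (Spec R).Modules} (r : Retract M N)
    [h : IsIso N.fromTildeΓ] : IsIso M.fromTildeΓ :=
  (MorphismProperty.isomorphisms _).of_retract
    (NatTrans.retractArrowApp Scheme.Modules.fromTildeΓNatTrans r) h

lemma isIso_fromTildeΓ_restrict_pushforward (f : S ⟶ T) {R : CommRingCat.{u}} (j : Spec R ⟶ T)
    [IsOpenImmersion j] (hP : IsAffineOpen (f ⁻¹ᵁ (j ''ᵁ ⊤))) :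
    IsIso (((Scheme.Modules.pushforward f).obj (structureModule S)).restrict j).fromTildeΓ := by
  rw [isIso_fromTildeΓ_iff_isLocalizing]
  intro r
  let N := ((Scheme.Modules.pushforward f).obj (structureModule S)).restrict j
  let D : (Spec R).Opens := PrimeSpectrum.basicOpen r
  let t : Γ(T, j ''ᵁ ⊤) := (j.appIso ⊤).inv ((Scheme.ΓSpecIso R).inv r)
  let s : Γ(S, f ⁻¹ᵁ (j ''ᵁ ⊤)) := f.app (j ''ᵁ ⊤) t
  have hst : f ⁻¹ᵁ (j ''ᵁ D) = S.basicOpen s := by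
    rw [← Scheme.preimage_basicOpen, ← Scheme.image_basicOpen, basicOpen_eq_of_affine]
  let i : f ⁻¹ᵁ (j ''ᵁ D) ⟶ f ⁻¹ᵁ (j ''ᵁ ⊤) :=
    (Opens.map f.base).map (j.opensFunctor.map (homOfLE le_top))
  let _ : Algebra Γ(S, f ⁻¹ᵁ (j ''ᵁ ⊤)) Γ(S, f ⁻¹ᵁ (j ''ᵁ D)) :=
    (S.presheaf.map i.op).hom.toAlgebra
  have hloc : IsLocalization.Away s Γ(S, f ⁻¹ᵁ (j ''ᵁ D)) :=
    hP.isLocalization_of_eq_basicOpen s i hst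
  have hsmul (x : Γ(N, ⊤)) : r • x = (show Γ(S, f ⁻¹ᵁ (j ''ᵁ ⊤)) from
      s * (show Γ(S, f ⁻¹ᵁ (j ''ᵁ ⊤)) from x)) := by
    rw [Scheme.Modules.smul_Spec_def]
    change f.app (j ''ᵁ ⊤) ((j.appIso ⊤).inv
      (((Spec R).presheaf.map (𝟙 _)) ((Scheme.ΓSpecIso R).inv r))) * _ = _
    rw [(Spec R).presheaf.map_id]
    rfl
  have hsmul' (x : Γ(N, D)) : r • x = (show Γ(S, f ⁻¹ᵁ (j ''ᵁ D)) from
      algebraMap _ _ s * (show Γ(S, f ⁻¹ᵁ (j ''ᵁ D)) from x)) := by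
    rw [Scheme.Modules.smul_Spec_def]
    change f.app (j ''ᵁ D) ((j.appIso D).inv
      (((Spec R).presheaf.map (homOfLE le_top).op) ((Scheme.ΓSpecIso R).inv r))) * _ =
        S.presheaf.map i.op (f.app (j ''ᵁ ⊤) ((j.appIso ⊤).inv ((Scheme.ΓSpecIso R).inv r))) * _
    congr 1
    have h : (Spec R).presheaf.map (homOfLE (le_top : D ≤ ⊤)).op ≫ (j.appIso D).inv ≫
        f.app (j ''ᵁ D) = (j.appIso ⊤).inv ≫ f.app (j ''ᵁ ⊤) ≫ S.presheaf.map i.op := by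
      rw [← Category.assoc, Scheme.Hom.appIso_inv_naturality, Category.assoc,
        Scheme.Hom.naturality]
      rfl
    exact congrArg (fun φ : Γ(Spec R, ⊤) ⟶ Γ(S, f ⁻¹ᵁ (j ''ᵁ D)) ↦
      φ ((Scheme.ΓSpecIso R).inv r)) h
  have hpow (n : ℕ) (x : Γ(N, ⊤)) : r ^ n • x = (show Γ(S, f ⁻¹ᵁ (j ''ᵁ ⊤)) from
      s ^ n * (show Γ(S, f ⁻¹ᵁ (j ''ᵁ ⊤)) from x)) := by
    induction n with
    | zero => rw [pow_zero, one_smul, pow_zero, one_mul]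
    | succ n ih => rw [pow_succ', mul_smul, hsmul, ih, pow_succ', mul_assoc]
  have hpow' (n : ℕ) (x : Γ(N, D)) : r ^ n • x =
      (show Γ(S, f ⁻¹ᵁ (j ''ᵁ D)) from
        algebraMap _ _ s ^ n *
          (show Γ(S, f ⁻¹ᵁ (j ''ᵁ D)) from x)) := by
    induction n with
    | zero => rw [pow_zero, one_smul, pow_zero, one_mul]
    | succ n ih => rw [pow_succ', mul_smul, hsmul', ih, pow_succ', mul_assoc]
  refine IsLocalizedModule.Away.mk_of_addCommGroup
    (Scheme.Modules.isUnit_algebraMap_end_of_le_basicOpen (M := N) r le_rfl) ?_ ?_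
  · intro x
    obtain ⟨⟨y, ⟨_, n, rfl⟩⟩, hy⟩ := IsLocalization.surj (Submonoid.powers s)
      (show Γ(S, f ⁻¹ᵁ (j ''ᵁ D)) from x)
    refine ⟨n, y, (hpow' n x).trans ?_⟩
    rw [mul_comm, ← map_pow]
    exact hy
  · intro x hx
    obtain ⟨⟨_, n, rfl⟩, hn⟩ := (IsLocalization.map_eq_zero_iff (Submonoid.powers s)
      Γ(S, f ⁻¹ᵁ (j ''ᵁ D)) (show Γ(S, f ⁻¹ᵁ (j ''ᵁ ⊤)) from x)).mp hx
    exact ⟨n, (hpow n x).trans hn⟩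

/-- A direct summand of `f_* 𝒪_S` is coherent, for a finite morphism `f`. -/
theorem isCoherent_of_retract (f : S ⟶ T) {M : T.Modules}
    (hf : ∀ U : T.Opens, IsAffineOpen U → IsAffineOpen (f ⁻¹ᵁ U))
    (hfin : ∀ U : T.Opens, IsAffineOpen U → (f.app U).hom.Finite)
    (inc : M ⟶ (Scheme.Modules.pushforward f).obj (structureModule S))
    (pr : (Scheme.Modules.pushforward f).obj (structureModule S) ⟶ M) (h : inc ≫ pr = 𝟙 M) :
    IsCoherent M := by
  refine ⟨isQuasicoherent_of_isIso_fromTildeΓ M fun U hU ↦ ?_, fun U hU ↦ ?_⟩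
  · have : IsIso (((Scheme.Modules.pushforward f).obj
        (structureModule S)).restrict hU.fromSpec).fromTildeΓ :=
      isIso_fromTildeΓ_restrict_pushforward f hU.fromSpec (hf _ (by
        rw [Scheme.Hom.image_top_eq_opensRange, hU.opensRange_fromSpec]; exact hU))
    exact isIso_fromTildeΓ_of_retract ((Retract.mk inc pr h).map
      (Scheme.Modules.restrictFunctor hU.fromSpec))
  · let N := (Scheme.Modules.pushforward f).obj (structureModule S)
    have : Module.Finite Γ(T, U) Γ(N, U) := hfin U hU
    let p : Γ(N, U) →ₗ[Γ(T, U)] Γ(M, U) :=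
      { toFun := pr.app U
        map_add' := map_add _
        map_smul' := fun r x ↦ pr.app_smul r x }
    refine Module.Finite.of_surjective p fun m ↦ ⟨inc.app U m, ?_⟩
    exact congrArg (fun φ : M ⟶ M ↦ φ.app U m) h

/-- A submodule of `f_* 𝒪_S` is torsion-free, for a dominant `f` with `S` integral. -/
theorem isTorsionFree_of_mono [IsIntegral S] (f : S ⟶ T) {M : T.Modules}
    (hf : ∀ U : T.Opens, Function.Injective (f.app U))
    (inc : M ⟶ (Scheme.Modules.pushforward f).obj (structureModule S))
    (hinc : ∀ U : T.Opens, Function.Injective (inc.app U)) : IsTorsionFree M := by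
  intro U r m hrm
  have h : f.app U r * (show Γ(S, f ⁻¹ᵁ U) from inc.app U m) = 0 :=
    (inc.app_smul r m).symm.trans ((congrArg (inc.app U) hrm).trans (map_zero (inc.app U).hom))
  by_cases hU : Nonempty (f ⁻¹ᵁ U)
  · refine (mul_eq_zero.mp h).imp (fun h ↦ hf U (h.trans (map_zero _).symm)) fun h ↦ hinc U ?_
    exact h.trans (map_zero (inc.app U).hom).symm
  · have hbot : f ⁻¹ᵁ U = ⊥ := by
      ext x
      simp only [Opens.coe_bot, Set.mem_empty_iff_false, iff_false]
      exact fun hx ↦ hU ⟨⟨x, hx⟩⟩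
    have : Subsingleton Γ(S, f ⁻¹ᵁ U) := by rw [hbot]; infer_instance
    exact Or.inl (hf U (Subsingleton.elim _ _))

end

end GaloisCover
end

noncomputable section
namespace GaloisCover

/-! ### The rank of the isotypic components of a Galois extension -/

section

variable {k : Type u} [Field k] {G : Type v} [Group G]

/-- The action of the group algebra on a ring with an action of `G`. -/
def groupAlgebraEnd (A : Type*) {B : Type*} [CommRing A] [CommRing B] [Algebra k A] [Algebra A B]
    [Algebra k B] [IsScalarTower k A B] [MulSemiringAction G B] [SMulCommClass G A B] :
    MonoidAlgebra k G →ₐ[k] Module.End A B :=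
  MonoidAlgebra.lift k (Module.End A B) G (DistribMulAction.toModuleEnd A B)

lemma groupAlgebraEnd_of {A B : Type*} [CommRing A] [CommRing B] [Algebra k A] [Algebra A B]
    [Algebra k B] [IsScalarTower k A B] [MulSemiringAction G B] [SMulCommClass G A B]
    (g : G) (b : B) : groupAlgebraEnd A (MonoidAlgebra.of k G g) b = g • b := by
  rw [groupAlgebraEnd, MonoidAlgebra.lift_of]
  rfl

lemma groupAlgebraEnd_algebraMap {A B K L : Type*} [CommRing A] [CommRing B] [CommRing K]
    [CommRing L] [Algebra k A] [Algebra A B] [Algebra k K] [Algebra K L] [Algebra k B]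
    [IsScalarTower k A B] [Algebra k L] [IsScalarTower k K L] [Algebra B L] [IsScalarTower k B L]
    [MulSemiringAction G B] [SMulCommClass G A B] [MulSemiringAction G L] [SMulCommClass G K L]
    [SMulDistribClass G B L] (a : MonoidAlgebra k G) (b : B) :
    groupAlgebraEnd K a (algebraMap B L b) = algebraMap B L (groupAlgebraEnd A a b) := by
  induction a using MonoidAlgebra.induction_on with
  | of g =>
    rw [groupAlgebraEnd_of, groupAlgebraEnd_of]
    exact (algebraMap.coe_smul' g b L).symm
  | add a b ha hb => simp only [map_add, LinearMap.add_apply, ha, hb]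
  | smul c a ha =>
    rw [map_smul, map_smul, LinearMap.smul_apply, LinearMap.smul_apply, ha, Algebra.smul_def,
      Algebra.smul_def, map_mul, ← IsScalarTower.algebraMap_apply]

/-- The isotypic parts of a field with an action of `G`. -/
lemma finrank_range_groupAlgebraEnd [Finite G] {ι : Type*} [Fintype ι] {V : ι → FDRep k G}
    (μ : MatrixUnits V) {i : ι} (z : Fin (Module.finrank k (V i))) (K L : Type*) [Field K]
    [Field L] [Algebra k K] [Algebra K L] [Algebra k L] [IsScalarTower k K L]
    [MulSemiringAction G L] [IsGaloisGroup G K L] :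
    Module.finrank K (LinearMap.range (groupAlgebraEnd (B := L) K (μ.unit i z z))) =
      Module.finrank k (V i) := by
  have := IsGaloisGroup.finiteDimensional G K L
  have := IsGaloisGroup.isGalois G K L
  let x : L := IsGalois.normalBasis K L 1
  let S := Σ i, Fin (Module.finrank k (V i)) × Fin (Module.finrank k (V i))
  let w : S → L := fun s ↦ groupAlgebraEnd K (μ.unit s.1 s.2.1 s.2.2) x
  have hspan : ⊤ ≤ Submodule.span K (Set.range w) := by
    have hw (a : MonoidAlgebra k G) : groupAlgebraEnd K a x ∈ Submodule.span K (Set.range w) := by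
      have ha : a ∈ Submodule.span k (Set.range fun x : S ↦ μ.unit x.1 x.2.1 x.2.2) := by
        rw [μ.span_unit]; trivial
      induction ha using Submodule.span_induction with
      | mem a ha =>
        obtain ⟨s, rfl⟩ := ha
        exact Submodule.subset_span ⟨s, rfl⟩
      | zero => simp
      | add a b _ _ ha hb => rw [map_add]; exact Submodule.add_mem _ ha hb
      | smul c a _ ha =>
        rw [map_smul, LinearMap.smul_apply, ← algebraMap_smul K c]
        exact Submodule.smul_mem _ _ ha
    rw [← (IsGalois.normalBasis K L).span_eq, Submodule.span_le]
    rintro _ ⟨σ, rfl⟩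
    rw [IsGalois.normalBasis_apply]
    obtain ⟨g, rfl⟩ := (IsGaloisGroup.mulEquivAlgEquiv G K L).surjective σ
    have := hw (MonoidAlgebra.of k G g)
    rw [groupAlgebraEnd_of] at this
    exact this
  have hli : LinearIndependent K w :=
    linearIndependent_of_top_le_span_of_card_eq_finrank hspan (by
      rw [← Nat.card_eq_fintype_card, μ.card_eq, IsGaloisGroup.card_eq_finrank G K L])
  let w' : Fin (Module.finrank k (V i)) → L := fun l ↦ w ⟨i, z, l⟩
  have hw' : LinearIndependent K w' := hli.comp (fun l ↦ ⟨i, z, l⟩) fun l l' h ↦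
    (Prod.ext_iff.mp (eq_of_heq (Sigma.mk.inj_iff.mp h).2)).2
  have hrange : LinearMap.range (groupAlgebraEnd (B := L) K (μ.unit i z z)) =
      Submodule.span K (Set.range w') := by
    rw [LinearMap.range_eq_map, ← top_le_iff.mp hspan, Submodule.map_span]
    apply le_antisymm <;> rw [Submodule.span_le]
    · rintro _ ⟨_, ⟨⟨i', j, l⟩, rfl⟩, rfl⟩
      change groupAlgebraEnd K (μ.unit i z z) (groupAlgebraEnd K (μ.unit i' j l) x) ∈ _
      rw [← Module.End.mul_apply, ← map_mul]
      by_cases h : i = i'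
      · subst h
        by_cases h : z = j
        · subst h
          rw [μ.unit_mul_unit]
          exact Submodule.subset_span ⟨l, rfl⟩
        · rw [μ.unit_mul_unit_of_ne _ _ _ _ _ h]
          simp
      · rw [μ.unit_mul_unit_of_index_ne _ _ _ _ _ _ h]
        simp
    · rintro _ ⟨l, rfl⟩
      refine Submodule.subset_span ⟨w' l, ⟨⟨i, z, l⟩, rfl⟩, ?_⟩
      change groupAlgebraEnd K (μ.unit i z z) (groupAlgebraEnd K (μ.unit i z l) x) =
        groupAlgebraEnd K (μ.unit i z l) x
      rw [← Module.End.mul_apply, ← map_mul, μ.unit_mul_unit]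
  rw [hrange, finrank_span_eq_card hw', Fintype.card_fin]

/-- The rank of an isotypic part of a Galois extension of domains. -/
theorem rank_eq_of_galois [Finite G] {ι : Type*} [Fintype ι] {V : ι → FDRep k G}
    (μ : MatrixUnits V) {i : ι} (z : Fin (Module.finrank k (V i))) {A B N : Type u} [CommRing A]
    [CommRing B] [IsDomain B] [Algebra k A] [Algebra A B] [Algebra k B] [IsScalarTower k A B]
    [FaithfulSMul A B] [MulSemiringAction G B] [IsGaloisGroup G A B] [AddCommGroup N] [Module A N]
    (inc : N →ₗ[A] B) (pr : B →ₗ[A] N) (h₁ : ∀ n, pr (inc n) = n)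
    (h₂ : ∀ b, inc (pr b) = groupAlgebraEnd A (μ.unit i z z) b) :
    Module.rank A N = Module.finrank k (V i) := by
  have := IsDomain.of_faithfulSMul A B
  let K := FractionRing A
  let L := FractionRing B
  let _ := FractionRing.liftAlgebra A L
  let _ := IsFractionRing.mulSemiringAction G B L
  have : IsGaloisGroup G K L := IsGaloisGroup.toFractionRing G A B
  have : IsScalarTower k K L := .of_algebraMap_eq fun c ↦ by
    rw [IsScalarTower.algebraMap_apply k A K, ← IsScalarTower.algebraMap_apply A K L,
      IsScalarTower.algebraMap_apply A B L, ← IsScalarTower.algebraMap_apply k A B,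
      ← IsScalarTower.algebraMap_apply k B L]
  have hfd := IsGaloisGroup.finiteDimensional G K L
  let f : Module.End K L := groupAlgebraEnd K (μ.unit i z z)
  have hf (b : B) : f (algebraMap B L b) = algebraMap B L (inc (pr b)) := by
    rw [h₂]
    exact groupAlgebraEnd_algebraMap _ b
  have hinc : Function.Injective inc := Function.LeftInverse.injective h₁
  have hrank : Module.finrank K (LinearMap.range f) = Module.finrank k (V i) :=
    finrank_range_groupAlgebraEnd μ z K L
  have hle₁ : Module.rank A N ≤ Module.rank K (LinearMap.range f) := by
    rw [IsFractionRing.rank_right_eq A K]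
    let φ : N →ₗ[A] LinearMap.range f :=
      { toFun n := ⟨algebraMap B L (inc n), ⟨algebraMap B L (inc n), by rw [hf, h₁]⟩⟩
        map_add' m n := by ext; simp
        map_smul' a n := by
          ext
          simp [Algebra.smul_def, ← IsScalarTower.algebraMap_apply] }
    refine LinearMap.rank_le_of_injective φ fun m n h ↦ hinc ?_
    exact IsFractionRing.injective B L (congrArg Subtype.val h)
  have hle₂ : Module.rank A (LinearMap.ker pr) ≤ Module.rank K (LinearMap.ker f) := by
    rw [IsFractionRing.rank_right_eq A K]
    let φ : LinearMap.ker pr →ₗ[A] LinearMap.ker f :=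
      { toFun n := ⟨algebraMap B L n.1, by rw [LinearMap.mem_ker, hf, n.2]; simp⟩
        map_add' m n := by ext; simp
        map_smul' a n := by
          ext
          simp [Algebra.smul_def, ← IsScalarTower.algebraMap_apply] }
    refine LinearMap.rank_le_of_injective φ fun m n h ↦ Subtype.ext ?_
    exact IsFractionRing.injective B L (congrArg Subtype.val h)
  have hsum : Module.rank A N + Module.rank A (LinearMap.ker pr) =
      Module.rank K (LinearMap.range f) + Module.rank K (LinearMap.ker f) := by
    have hB : Module.rank A B ≤ Module.rank K L := by
      rw [IsFractionRing.rank_right_eq A K]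
      exact LinearMap.rank_le_of_injective (Algebra.linearMap B L |>.restrictScalars A)
        (IsFractionRing.injective B L)
    rw [LinearMap.rank_range_add_rank_ker,
      ← LinearMap.rank_eq_of_surjective (fun n ↦ ⟨inc n, h₁ n⟩ : Function.Surjective pr),
      ← Module.finrank_eq_rank K L, IsFractionRing.finrank_eq A K B L]
    exact (Cardinal.cast_toNat_of_lt_aleph0 (hB.trans_lt (Module.rank_lt_aleph0 K L))).symm
  rw [← Module.finrank_eq_rank K (LinearMap.range f)] at hle₁ hsum
  rw [← Module.finrank_eq_rank K (LinearMap.ker f)] at hle₂ hsum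
  obtain ⟨m, hm⟩ := Cardinal.lt_aleph0.mp (hle₁.trans_lt (Cardinal.natCast_lt_aleph0))
  obtain ⟨n, hn⟩ := Cardinal.lt_aleph0.mp (hle₂.trans_lt (Cardinal.natCast_lt_aleph0))
  rw [hm, hn] at hsum
  rw [hm] at hle₁
  rw [hn] at hle₂
  rw [hm, ← hrank]
  norm_cast at *
  omega

end

end GaloisCover
end

noncomputable section
namespace GaloisCover

/-! ### The rank of a direct summand of a direct image -/

section

variable {S T : Scheme.{u}}

lemma germ_smul [IsIntegral T] (M : T.Modules) (U : T.Opens) (hU : genericPoint T ∈ U) (r : Γ(T, U))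
    (m : Γ(M, U)) : (TopCat.Presheaf.germ M.presheaf U _ hU (r • m) : GenericStalk M) =
      (T.presheaf.germ U _ hU r : T.functionField) •
        (TopCat.Presheaf.germ M.presheaf U _ hU m : GenericStalk M) :=
  let P : PresheafOfModules.{u} (T.presheaf ⋙ forget₂ CommRingCat RingCat) := M.val
  PresheafOfModules.germ_smul P _ U hU r m

/-- The generic stalk as a module over the functions on an open subset. -/
@[reducible] def moduleGenericStalk [IsIntegral T] (M : T.Modules) (U : T.Opens) [Nonempty U] :
    Module Γ(T, U) (GenericStalk M) :=
  Module.compHom _ (algebraMap Γ(T, U) T.functionField)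

attribute [local instance] moduleGenericStalk

instance [IsIntegral T] (M : T.Modules) (U : T.Opens) [Nonempty U] :
    IsScalarTower Γ(T, U) T.functionField (GenericStalk M) :=
  ⟨fun r c x ↦ by
    rw [Algebra.smul_def, mul_smul]
    rfl⟩

/-- Over an affine open subset, the rank of a direct summand of a direct image is the rank of the
module of sections. -/
lemma rank_eq_rank_sections [IsIntegral S] [IsIntegral T] (f : S ⟶ T) {M : T.Modules}
    (hf : ∀ U : T.Opens, Function.Injective (f.app U))
    (inc : M ⟶ (Scheme.Modules.pushforward f).obj (structureModule S))
    (pr : (Scheme.Modules.pushforward f).obj (structureModule S) ⟶ M) (h : inc ≫ pr = 𝟙 M)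
    {U : T.Opens} (hU : IsAffineOpen U) (hfU : IsAffineOpen (f ⁻¹ᵁ U)) [Nonempty U] :
    rank M = Module.rank Γ(T, U) Γ(M, U) := by
  have hη (W : T.Opens) (hW : Nonempty W) : genericPoint T ∈ W :=
    ((genericPoint_spec T).mem_open_set_iff W.isOpen).mpr (by simpa using hW)
  have hηU := hη U inferInstance
  have hfr := functionField_isFractionRing_of_isAffineOpen T U hU
  have hprinc (W : T.Opens) (m : Γ(M, W)) : pr.app W (inc.app W m) = m :=
    congrArg (fun φ : M ⟶ M ↦ φ.app W m) h
  have hne (W : T.Opens) (hW : Nonempty W) : Nonempty (f ⁻¹ᵁ W) := by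
    by_contra hW'
    have hbot : f ⁻¹ᵁ W = ⊥ := by
      ext x
      simp only [Opens.coe_bot, Set.mem_empty_iff_false, iff_false]
      exact fun hx ↦ hW' ⟨⟨x, hx⟩⟩
    have : Subsingleton Γ(S, f ⁻¹ᵁ W) := by rw [hbot]; infer_instance
    exact one_ne_zero (hf W (Subsingleton.elim (f.app W 1) (f.app W 0)))
  let germU : Γ(M, U) →ₗ[Γ(T, U)] GenericStalk M :=
    { toFun := TopCat.Presheaf.germ M.presheaf U _ hηU
      map_add' := map_add _
      map_smul' := germ_smul M U hηU }
  have hloc : IsLocalizedModule (nonZeroDivisors Γ(T, U)) germU := by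
    refine ⟨fun r ↦ ?_, fun x ↦ ?_, fun {m n} hmn ↦ ?_⟩
    · have hr := IsLocalization.map_units T.functionField r
      exact (Module.End.isUnit_iff _).mpr (MulAction.bijective hr.unit)
    · obtain ⟨W, hW, m, rfl⟩ := TopCat.Presheaf.exists_germ_eq M.presheaf x
      obtain ⟨s, hs, hηs⟩ := hU.exists_basicOpen_le (V := U ⊓ W) ⟨_, ⟨hηU, hW⟩⟩ hηU
      let i : T.basicOpen s ⟶ U := homOfLE (T.basicOpen_le s)
      let i' : T.basicOpen s ⟶ W := homOfLE (hs.trans inf_le_right)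
      let j : f ⁻¹ᵁ T.basicOpen s ⟶ f ⁻¹ᵁ U := (Opens.map f.base).map i
      let _ : Algebra Γ(S, f ⁻¹ᵁ U) Γ(S, f ⁻¹ᵁ T.basicOpen s) := (S.presheaf.map j.op).hom.toAlgebra
      have hloc : IsLocalization.Away (f.app U s) Γ(S, f ⁻¹ᵁ T.basicOpen s) :=
        hfU.isLocalization_of_eq_basicOpen _ j (f.preimage_basicOpen s)
      let m' : Γ(M, T.basicOpen s) := M.presheaf.map i'.op m
      have hm' : TopCat.Presheaf.germ M.presheaf W _ hW m =
          TopCat.Presheaf.germ M.presheaf _ _ hηs m' :=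
        (TopCat.Presheaf.germ_res_apply M.presheaf i' _ hηs m).symm
      obtain ⟨⟨b, ⟨_, n, rfl⟩⟩, hb⟩ := IsLocalization.surj (Submonoid.powers (f.app U s))
        (show Γ(S, f ⁻¹ᵁ T.basicOpen s) from inc.app _ m')
      have hb' : M.presheaf.map i.op (pr.app U b) = (T.presheaf.map i.op (s ^ n)) • m' := by
        have h₁ : M.presheaf.map i.op (pr.app U b) =
            pr.app (T.basicOpen s) (S.presheaf.map j.op b) :=
          (ConcreteCategory.congr_hom (pr.mapPresheaf.naturality i.op) b).symm
        have h₂ : S.presheaf.map j.op (f.app U s) = f.app _ (T.presheaf.map i.op s) :=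
          (ConcreteCategory.congr_hom (f.naturality i.op) s).symm
        have hb₂ : (show Γ(S, f ⁻¹ᵁ T.basicOpen s) from inc.app _ m') *
          S.presheaf.map j.op (f.app U s ^ n) = S.presheaf.map j.op b := hb
        rw [h₁, ← hb₂, mul_comm, map_pow, h₂, ← map_pow, ← map_pow]
        refine (pr.app_smul (T.presheaf.map i.op (s ^ n)) (inc.app _ m')).trans ?_
        rw [hprinc]
      have hs0 : s ≠ 0 := by
        rintro rfl
        rw [Scheme.basicOpen_zero] at hηs
        exact hηs
      refine ⟨⟨pr.app U b, ⟨s ^ n, mem_nonZeroDivisors_of_ne_zero (pow_ne_zero n hs0)⟩⟩, ?_⟩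
      change (algebraMap Γ(T, U) T.functionField (s ^ n)) • _ =
        TopCat.Presheaf.germ M.presheaf U _ hηU (pr.app U b)
      rw [hm', ← TopCat.Presheaf.germ_res_apply M.presheaf i _ hηs, hb']
      refine Eq.trans ?_ (germ_smul M _ hηs _ _).symm
      exact congrArg (fun c : T.functionField ↦ c • (TopCat.Presheaf.germ M.presheaf _ _ hηs m' :
        GenericStalk M)) (TopCat.Presheaf.germ_res_apply T.presheaf i _ hηs (s ^ n)).symm
    · refine ⟨1, ?_⟩
      rw [one_smul, one_smul]
      obtain ⟨W, hW, i, i', hi⟩ := TopCat.Presheaf.germ_eq M.presheaf _ hηU hηU m n hmn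
      obtain rfl := Subsingleton.elim i i'
      rw [← hprinc U m, ← hprinc U n]
      congr 1
      have := hne W ⟨_, hW⟩
      refine map_injective_of_isIntegral S ((Opens.map f.base).map i) ?_
      have hres (m : Γ(M, U)) : S.presheaf.map ((Opens.map f.base).map i).op (inc.app U m) =
          inc.app W (M.presheaf.map i.op m) :=
        (ConcreteCategory.congr_hom (inc.mapPresheaf.naturality i.op) m).symm
      refine (hres m).trans (.trans ?_ (hres n).symm)
      rw [hi]
  rw [rank, IsFractionRing.rank_right_eq Γ(T, U) T.functionField,
    IsLocalizedModule.rank_eq (nonZeroDivisors Γ(T, U)) le_rfl germU]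

end

/-! ### The ring extension of functions of a quotient -/

section

variable {k : Type u} [Field k] {X Y : Over (Spec (.of k))} {G : Type v} [Group G]

attribute [local instance] algebraSections preimageAlgebra

lemma isScalarTower_sections (π : X ⟶ Y) (U : Y.left.Opens) :
    IsScalarTower k Γ(Y.left, U) Γ(X.left, π.left ⁻¹ᵁ U) :=
  .of_algebraMap_eq fun c ↦ by
    have h : X.hom.appTop ≫ X.left.presheaf.map (homOfLE (le_top (a := π.left ⁻¹ᵁ U))).op =
        (Y.hom.appTop ≫ Y.left.presheaf.map (homOfLE (le_top (a := U))).op) ≫ π.left.app U := by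
      rw [Category.assoc, Scheme.Hom.naturality, ← Over.w π, Scheme.Hom.comp_appTop,
        Category.assoc]
      rfl
    exact congrArg (fun φ : Γ(Spec (.of k), ⊤) ⟶ Γ(X.left, π.left ⁻¹ᵁ U) ↦
      φ ((Scheme.ΓSpecIso (.of k)).inv c)) h

lemma act_app_eq_groupAlgebraEnd {a : G →* Aut X} {π : X ⟶ Y} (hπ : IsQuotient a π)
    (U : Y.left.Opens) (b : MonoidAlgebra k G) (s : Γ(X.left, π.left ⁻¹ᵁ U)) :
    letI := sectionsAction a π hπ.invariant U
    haveI := hπ.smulCommClass U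
    haveI := isScalarTower_sections π U
    (act (pushforwardModule a π hπ.invariant) b).app U s =
      groupAlgebraEnd Γ(Y.left, U) b s := by
  let _ := sectionsAction a π hπ.invariant U
  have := hπ.smulCommClass U
  have := isScalarTower_sections π U
  induction b using MonoidAlgebra.induction_on generalizing s with
  | of g =>
    rw [act_of, groupAlgebraEnd_of]
    rfl
  | add b c hb hc =>
    rw [map_add, LinearMap.add_apply, ← hb, ← hc, act, map_add]
    rfl
  | smul c b hb =>
    rw [map_smul, LinearMap.smul_apply, ← hb, act_smul, scalar_comp]
    exact algebraMap_smul Γ(Y.left, U) c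
      (show Γ(X.left, π.left ⁻¹ᵁ U) from (act (pushforwardModule a π hπ.invariant) b).app U s)

variable {a : G →* Aut X} {π : X ⟶ Y}

lemma eq_id_of_appLE_eq_id [IsVariety X] (σ : X ⟶ X) {W : X.left.Opens} (hW : IsAffineOpen W)
    [Nonempty W] (hle : W ≤ σ.left ⁻¹ᵁ W) (h : σ.left.appLE W W hle = 𝟙 _) : σ = 𝟙 X := by
  ext1
  have : IsAffine W.toScheme := hW
  have : IsDominant W.ι := ⟨by
    rw [DenseRange, Scheme.Opens.range_ι]
    exact W.isOpen.dense ⟨_, (Classical.arbitrary W).2⟩⟩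
  refine ext_of_isDominant_of_isSeparated X.hom (by simp) W.ι ?_
  rw [← Scheme.Hom.resLE_comp_ι σ.left hle]
  have : σ.left.resLE W W hle = 𝟙 W.toScheme := by
    refine ext_of_isAffine ?_
    rw [Scheme.Hom.appTop, Scheme.Hom.resLE_app_top, h, Category.id_comp, Iso.hom_inv_id]
    rfl
  rw [this]
  simp

lemma IsQuotient.isGaloisGroup [IsVariety X] [IsVariety Y] [Finite G] (hπ : IsQuotient a π)
    (ha : Function.Injective a) {U : Y.left.Opens} (hU : IsAffineOpen U)
    [Nonempty (π.left ⁻¹ᵁ U)] :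
    letI := sectionsAction a π hπ.invariant U
    IsGaloisGroup G Γ(Y.left, U) Γ(X.left, π.left ⁻¹ᵁ U) := by
  let _ := sectionsAction a π hπ.invariant U
  refine ⟨⟨fun {g g'} h ↦ ?_⟩, hπ.smulCommClass U, hπ.isInvariant U⟩
  have h' (s : Γ(X.left, π.left ⁻¹ᵁ U)) : (g'⁻¹ * g) • s = s := by
    rw [mul_smul, h, inv_smul_smul]
  have := eq_id_of_appLE_eq_id (a (g'⁻¹ * g)⁻¹).hom (hπ.isAffineOpen_preimage hU)
    (le_preimage (left_comp_eq hπ.invariant _) U) (by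
      ext s
      exact h' s)
  have h1 : (g'⁻¹ * g)⁻¹ = 1 := ha (by
    rw [map_one]
    exact Iso.ext this)
  rw [inv_eq_one, inv_mul_eq_one] at h1
  exact h1.symm

/-- The rank of a direct summand of `π_* 𝒪_X` cut out by a matrix unit. -/
lemma IsQuotient.rank_eq [IsVariety X] [IsVariety Y] [Finite G] (hπ : IsQuotient a π)
    (ha : Function.Injective a) {ι : Type*} [Fintype ι] {V : ι → FDRep k G} (μ : MatrixUnits V)
    {i : ι} (z : Fin (Module.finrank k (V i))) {E : Y.left.Modules}
    (inc : E ⟶ (pushforwardModule a π hπ.invariant).V)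
    (pr : (pushforwardModule a π hπ.invariant).V ⟶ E) (h₁ : inc ≫ pr = 𝟙 E)
    (h₂ : pr ≫ inc = act (pushforwardModule a π hπ.invariant) (μ.unit i z z)) :
    rank E = Module.finrank k (V i) := by
  obtain ⟨_, ⟨U, hU, rfl⟩, hηU, -⟩ := Y.left.isBasis_affineOpens.exists_subset_of_mem_open
    (Set.mem_univ (π.left (genericPoint X.left))) isOpen_univ
  have : Nonempty U := ⟨_, hηU⟩
  have : Nonempty (π.left ⁻¹ᵁ U) := ⟨genericPoint X.left, hηU⟩
  have hfU := hπ.isAffineOpen_preimage hU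
  let _ := sectionsAction a π hπ.invariant U
  have := hπ.smulCommClass U
  have := isScalarTower_sections π U
  have := hπ.isGaloisGroup ha hU
  have : FaithfulSMul Γ(Y.left, U) Γ(X.left, π.left ⁻¹ᵁ U) :=
    (faithfulSMul_iff_algebraMap_injective _ _).mpr (hπ.injective U)
  rw [rank_eq_rank_sections π.left hπ.injective inc pr h₁ hU hfU]
  let incU : Γ(E, U) →ₗ[Γ(Y.left, U)] Γ(X.left, π.left ⁻¹ᵁ U) :=
    { toFun := inc.app U
      map_add' := map_add _
      map_smul' := inc.app_smul }
  let prU : Γ(X.left, π.left ⁻¹ᵁ U) →ₗ[Γ(Y.left, U)] Γ(E, U) :=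
    { toFun := pr.app U
      map_add' := map_add _
      map_smul' := pr.app_smul }
  refine rank_eq_of_galois μ z incU prU
    (fun n ↦ congrArg (fun φ : E ⟶ E ↦ φ.app U n) h₁) fun b ↦ ?_
  rw [← act_app_eq_groupAlgebraEnd hπ U, ← h₂]
  rfl

end

end GaloisCover
end

open GaloisCover
theorem theorem4 {k : Type u} [Field k] [IsAlgClosed k] {G : Type v} [Group G] [Finite G]
    (hG : ¬ ringChar k ∣ Nat.card G) {X Y : Over (Spec (.of k))} [IsVariety X] [IsVariety Y]
    (a : G →* Aut X) (ha : Function.Injective a) (π : X ⟶ Y) (hπ : IsQuotient a π)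
    {r : ℕ} (V : Fin (r + 1) → FDRep k G)
    (hV_zero : Nonempty (V 0 ≅ FDRep.of (Representation.trivial k G k)))
    (hV_simple : ∀ i, Simple (V i))
    (hV_inj : ∀ i j, Nonempty (V i ≅ V j) → i = j)
    (hV_surj : ∀ W : FDRep k G, Simple W → ∃ i, Nonempty (W ≅ V i)) :
    ∃ (E : Fin r → Y.left.Modules)
      (φ : (Action.trivial G (structureModule Y.left) ⊞
          ⨁ fun i : Fin r ↦ isotypicModule Y (V i.succ) (E i)) ≅
        pushforwardModule a π hπ.invariant),
      ((biprod.inl :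
          Action.trivial G (structureModule Y.left) ⟶ Action.trivial G (structureModule Y.left) ⊞
            ⨁ fun i : Fin r ↦ isotypicModule Y (V i.succ) (E i)) ≫ φ.hom).hom =
        comorphism π.left ∧
      ∀ i : Fin r, IsCoherent (E i) ∧ IsTorsionFree (E i) ∧
        rank (E i) = Module.finrank k (V i.succ) := by
  obtain ⟨μ⟩ := nonempty_matrixUnits hG V hV_simple hV_inj hV_surj
  have z (i) : Fin (Module.finrank k (V i)) := ⟨0, finrank_pos_of_simple (V i)⟩
  let M := pushforwardModule a π hπ.invariant
  have hsplit (i : Fin r) := IsIdempotentComplete.idempotents_split M.V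
    (act M (μ.unit i.succ (z i.succ) (z i.succ)))
    ((act_comp_act M _ _).trans (by rw [μ.unit_mul_unit]))
  choose E inc pr h₁ h₂ using hsplit
  obtain ⟨φ, hφ⟩ := exists_decomposition μ z hV_zero M (comorphism π.left)
    (comorphism_comp_ρ a π hπ.invariant) hπ.injective (fun U m hm ↦ by
      obtain ⟨t, ht⟩ := hπ.exists_of_invariant U m fun g ↦ by
        have h := hm g⁻¹
        change pullbackHom a π hπ.invariant U g⁻¹⁻¹ m = m at h
        rwa [inv_inv] at h
      exact ⟨t, ht⟩) E inc pr h₁ h₂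
  refine ⟨E, φ, hφ, fun i ↦ ⟨?_, ?_, hπ.rank_eq ha μ (z i.succ) (inc i) (pr i) (h₁ i) (h₂ i)⟩⟩
  · exact isCoherent_of_retract π.left (fun U hU ↦ hπ.isAffineOpen_preimage hU)
      (fun U hU ↦ hπ.finite_preimage hU) (inc i) (pr i) (h₁ i)
  · exact isTorsionFree_of_mono π.left hπ.injective (inc i) fun U ↦
      Function.LeftInverse.injective (g := (pr i).app U) fun m ↦
        congrArg (fun φ : E i ⟶ E i ↦ φ.app U m) (h₁ i)
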